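/- Setting. Let $P\ge 1$, let $\mathcal D=(X,Y)$ with $X\in\mathbb R^{N\times P}$, $Y\in\mathbb R^N$, and let $h\in(0,1)$, $\tau,\nu_0,\lambda_0>0$. Consider the Bayesian variable selection model in which the coordinates of $\gamma\in\{0,1\}^P$ are independent $\mathrm{Bern}(h)$, $\sigma_\gamma^2\sim\mathrm{InvGamma}(\nu_0/2,\nu_0\lambda_0/2)$, $\beta_\gamma\mid\sigma_\gamma^2\sim\mathcal N(0,\sigma_\gamma^2\tau^{-1}I_{|\gamma|})$, and, conditionally on these, the $Y_n$ are independent with $Y_n\sim\mathcal N(\beta_\gamma\cdot X_{n\gamma},\sigma_\gamma^2)$. Let $p(\gamma)=p(\gamma\mid\mathcal D)$ be the posterior distribution, and let $p(\gamma_j\mid\gamma_{-j})$ be its conditional distributions, where $\gamma_{-j}$ denotes the coordinates of $\gamma$ other than $\gamma_j$. Put $\mathrm{PIP}(i)=p(\gamma_i=1)$. For each $j$ let $\eta_j(\gamma_{-j})>0$ be a weighting function, and put $$w_j(\gamma)=\frac{\frac12\eta_j(\gamma_{-j})}{p(\gamma_j\mid\gamma_{-j})},\quad \phi(\gamma)=\sum_{j=1}^P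 w_j(\gamma),\quad f(j\mid\gamma)=\frac{w_j(\gamma)}{\phi(\gamma)},\quad \pi(\gamma)=\frac{\phi(\gamma)p(\gamma)}{\sum_{\gamma'}\phi(\gamma')p(\gamma')},\quad \hat\phi(\gamma)=\frac{\phi^{-1}(\gamma)}{\max_{\gamma'}\phi^{-1}(\gamma')}.$$ Let $0<S<P$, let $q$ be the $\mathrm{Bern}(S/P)$ distribution, let $\pi(\gamma,Q)=\pi(\gamma)q(Q)$ on $\{0,1\}^P\times\{0,1\}$, and let $K$ be the transition kernel (reversible with respect to $\pi$) $$K((\gamma,Q)\to(\gamma',Q'))=K^*(\gamma\to\gamma')\,q(Q'),\qquad K^*(\gamma\to\gamma')=\frac SP\sum_{j=1}^P f(j\mid\gamma)\mathbf 1\{\gamma'=\mathrm{flip}(\gamma\mid j)\}+\Big(1-\frac SP\Big)\mathbf 1\{\gamma'=\gamma\},$$ where $\mathrm{flip}(\gamma\mid j)$ flips the $j$-th coordinate of $\gamma$. Let $\lambda_{\gamma,Q}=\|K-E_\pi\|_{L_2(\pi)\to L_2(\pi)}$, where $E_\pi v=\mathbb E_\pi[v]$. Let $(\gamma^{(t)},Q^{(t)})_{t\ge1}$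 be a Markov chain with $Q^{(1)}=1$ almost surely and arbitrary law of $\gamma^{(1)}$, whose transition kernel is either $K$, or the kernel of the variable-complexity weighted tempered Gibbs sampler: draw $Q^{(t)}\sim\mathrm{Bern}(S/P)$; if $Q^{(t)}=1$, draw $j\sim f(\cdot\mid\gamma^{(t-1)})$ and set $\gamma^{(t)}=\mathrm{flip}(\gamma^{(t-1)}\mid j)$; if $Q^{(t)}=0$, set $\gamma^{(t)}=\gamma^{(t-1)}$. Let $i\in\{1,\dots,P\}$ and, for $T\ge1$, $$\rho^{(t)}=\frac{\phi^{-1}(\gamma^{(t)})Q^{(t)}}{\sum_{s=1}^T\phi^{-1}(\gamma^{(s)})Q^{(s)}},\qquad \varepsilon_0=\varepsilon_0(T)=\frac{P}{\mathrm{PIP}(i)\,\mathbb E_\pi[\hat\phi(\gamma)]\,S}\sqrt{\frac{64e\log T}{(1-\lambda_{\gamma,Q})T}}.$$ Claim. For every $T\ge1$ with $\varepsilon_0(T)<1$, $$\mathbb E\bigg[\bigg|\sum_{t=1}^T\rho^{(t)}p(\gamma_i=1\mid\gamma_{-i}=\gamma_{-i}^{(t)})-\mathrm{PIP}(i)\bigg|^2\bigg]\le\frac{4\varepsilon_0^2}{(1-\varepsilon_0)^2}\mathrm{PIP}(i)^2+\frac{4P}{S}\,\frac{1}{\min_\gamma\pi(\gamma)\,T}.$$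 As $T\to\infty$ with everything else fixed, the right-hand side tends to $0$, and hence so does the mean-squared error. -/

import Mathlib

open MeasureTheory ProbabilityTheory Filter Topology

noncomputable section

namespace VCwTGS

/-- A Bayesian variable selection problem: a dataset `(X, Y)` with `N` observations of `P` covariates
together with the hyperparameters of the prior. -/
structure BVS (P N : ℕ) where
  X : Matrix (Fin N) (Fin P) ℝ
  Y : Fin N → ℝ
  /-- prior inclusion probability -/
  h : ℝ
  /-- prior precision of the coefficients -/
  τ : ℝ
  ν₀ : ℝ
  lam₀ : ℝ
  h_pos : 0 < h
  h_lt_one : h < 1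
  τ_pos : 0 < τ
  ν₀_pos : 0 < ν₀
  lam₀_pos : 0 < lam₀

/-- An inclusion vector `γ ∈ {0,1}^P`. -/
abbrev Incl (P : ℕ) := Fin P → Bool

/-- The inverse gamma distribution with shape `a` and scale `b`: the law of `1 / x`, where `x` is
gamma distributed with shape `a` and rate `b`. -/
def invGammaMeasure (a b : ℝ) : Measure ℝ := (gammaMeasure a b).map (fun x => x⁻¹)

namespace BVS

variable {P N : ℕ} (M : BVS P N)

/-- The prior `p(γ)`: the coordinates are independent Bernoulli(`h`). -/
def prior (γ : Incl P) : ℝ := ∏ j, (if γ j then M.h else 1 - M.h)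

/-- The marginal likelihood `p(Y | γ, X)`: the density of `Y_n ~ N(β_γ · X_{nγ}, σ²)` times that of
`β_γ ~ N(0, σ² τ⁻¹ I)`, integrated over `β_γ` with respect to the Lebesgue measure and then over
`σ² ~ InvGamma(ν₀ / 2, ν₀ λ₀ / 2)` (here `s = σ²`). -/
def marginalLikelihood (γ : Incl P) : ENNReal :=
  ∫⁻ s, (∫⁻ β : {j : Fin P // γ j = true} → ℝ,
      (∏ j, gaussianPDF 0 (s / M.τ).toNNReal (β j)) *
        ∏ n, gaussianPDF (∑ j, β j * M.X n j.1) s.toNNReal (M.Y n))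
  ∂(invGammaMeasure (M.ν₀ / 2) (M.ν₀ * M.lam₀ / 2))

/-- The posterior `p(γ | D)`, by the Bayes formula. -/
def posterior (γ : Incl P) : ℝ :=
  (ENNReal.ofReal (M.prior γ) * M.marginalLikelihood γ /
    ∑ γ', ENNReal.ofReal (M.prior γ') * M.marginalLikelihood γ').toReal

end BVS

section Sampler

variable {P : ℕ} (p : Incl P → ℝ) (η : (j : Fin P) → ({k : Fin P // k ≠ j} → Bool) → ℝ) (S : ℝ)

/-- The posterior inclusion probability `PIP(i) = p(γ_i = 1)`. -/
def PIP (i : Fin P) : ℝ := ∑ γ : Incl P, if γ i then p γ else 0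

/-- The conditional probability that the `j`-th coordinate is `b`, given the other coordinates of `γ`. -/
def condProb (j : Fin P) (b : Bool) (γ : Incl P) : ℝ :=
  p (Function.update γ j b) / (p (Function.update γ j true) + p (Function.update γ j false))

/-- `flip(γ | j)`: flip the `j`-th coordinate of `γ`. -/
def flipAt (γ : Incl P) (j : Fin P) : Incl P := Function.update γ j (!γ j)

/-- The weight `(1/2) η(γ_{-j}) / p(γ_j | γ_{-j})`. -/
def weight (j : Fin P) (γ : Incl P) : ℝ :=
  (1 / 2 * η j (fun k => γ k.1)) / condProb p j (γ j) γ

/-- `φ(γ) = ∑_j (1/2) η(γ_{-j}) / p(γ_j | γ_{-j})`. -/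
def phi (γ : Incl P) : ℝ := ∑ j, weight p η j γ

/-- `f(j | γ)`, the probability of choosing the coordinate `j` to flip. -/
def chooseProb (j : Fin P) (γ : Incl P) : ℝ := (phi p η γ)⁻¹ * weight p η j γ

/-- The unnormalized target `f(γ) = φ(γ) p(γ)`. -/
def target (γ : Incl P) : ℝ := phi p η γ * p γ

/-- `φ̂(γ) = φ⁻¹(γ) / max φ⁻¹`. -/
def phiHat (γ : Incl P) : ℝ := (phi p η γ)⁻¹ / ⨆ γ', (phi p η γ')⁻¹

/-- `π(γ) = f(γ) / Z_f`, the `γ`-marginal of the stationary distribution. -/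
def piMarg (γ : Incl P) : ℝ := target p η γ / ∑ γ', target p η γ'

/-- A state `(γ, Q)` of the chain. -/
abbrev State (P : ℕ) := Incl P × Bool

/-- The Bernoulli(`S / P`) probability mass function `q`. -/
def bern (P : ℕ) (S : ℝ) (b : Bool) : ℝ := if b then S / P else 1 - S / P

/-- The stationary distribution `π(γ, Q) = π(γ) q(Q)`. -/
def piJoint (x : State P) : ℝ := piMarg p η x.1 * bern P S x.2

/-- `K*(γ → γ') = (S/P) ∑_j f(j | γ) δ(γ' - flip(γ | j)) + (1 - S/P) δ(γ' - γ)`. -/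
def kernelStar (γ γ' : Incl P) : ℝ :=
  S / P * (∑ j, chooseProb p η j γ * (if γ' = flipAt γ j then 1 else 0)) +
    (1 - S / P) * (if γ' = γ then 1 else 0)

/-- The reversible kernel `K((γ,Q) → (γ',Q')) = K*(γ → γ') q(Q')`. -/
def kernelRev (x y : State P) : ℝ := kernelStar p η S x.1 y.1 * bern P S y.2

/-- One iteration of the variable-complexity sampler, read literally: draw `Q' ~ Bern(S/P)`; if `Q' = 1`
flip a coordinate drawn from `f(· | γ)`, and if `Q' = 0` keep `γ`. -/
def kernelAlg (x y : State P) : ℝ :=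
  if y.2 then S / P * (∑ j, chooseProb p η j x.1 * (if y.1 = flipAt x.1 j then 1 else 0))
  else (1 - S / P) * (if y.1 = x.1 then 1 else 0)

end Sampler

section Chain

variable {E : Type*} [Fintype E]

/-- The norm of `L₂(π)` on a finite state space. -/
def l2norm (π : E → ℝ) (v : E → ℂ) : ℝ := Real.sqrt (∑ x, π x * ‖v x‖ ^ 2)

/-- The operator `K - E_π`, where `(E_π v)(x) = ∑_y π(y) v(y)`. -/
def centered (π : E → ℝ) (K : E → E → ℝ) (v : E → ℂ) (x : E) : ℂ :=
  ∑ y, ((K x y : ℂ) - (π y : ℂ)) * v y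

/-- `λ = ‖K - E_π‖`, the operator norm on `L₂(π)`. -/
def opNorm (π : E → ℝ) (K : E → E → ℝ) : ℝ :=
  sSup {r : ℝ | ∃ v : E → ℂ, l2norm π v = 1 ∧ r = l2norm π (centered π K v)}

/-- `(Z_t)_{t ≥ 1}` is a Markov chain on a finite state space with transition matrix `K` (the initial
distribution is the law of `Z 1`; the value `Z 0` plays no role). -/
def IsMarkovChain [MeasurableSpace E] {Ω : Type*} [MeasurableSpace Ω] (μ : Measure Ω)
    (K : E → E → ℝ) (Z : ℕ → Ω → E) : Prop :=
  (∀ t, 1 ≤ t → Measurable (Z t)) ∧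
  ∀ (n : ℕ) (x : ℕ → E), 1 ≤ n →
    μ.real {ω | ∀ t ∈ Finset.Icc 1 n, Z t ω = x t} =
      μ.real {ω | Z 1 ω = x 1} * ∏ t ∈ Finset.Ico 1 n, K (x t) (x (t + 1))

end Chain

section Estimator

variable {P : ℕ} (p : Incl P → ℝ) (η : (j : Fin P) → ({k : Fin P // k ≠ j} → Bool) → ℝ) (S : ℝ)

/-- The unnormalized importance weight `φ⁻¹(γ) Q` of a state. -/
def rawWeight (x : State P) : ℝ := (phi p η x.1)⁻¹ * (if x.2 then 1 else 0)

/-- The Rao-Blackwellized estimator `∑_{t=1}^T ρ_t p(γ_i = 1 | γ_{-i})` along a path `z`, with `ρ_t` the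
normalized importance weights. -/
def estimator (i : Fin P) (T : ℕ) (z : ℕ → State P) : ℝ :=
  ∑ t ∈ Finset.Icc 1 T,
    rawWeight p η (z t) / (∑ s ∈ Finset.Icc 1 T, rawWeight p η (z s)) * condProb p i true (z t).1

/-- The mean-squared error of the estimator after `T` iterations. -/
def mse {Ω : Type*} [MeasurableSpace Ω] (μ : Measure Ω) (Z : ℕ → Ω → State P) (i : Fin P) (T : ℕ) : ℝ :=
  ∫ ω, |estimator p η i T (fun t => Z t ω) - PIP p i| ^ 2 ∂μ

/-- `λ_{γ,Q}`, the norm of `K - E_π` on `L₂(π)` for the reversible kernel `K`. -/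
def lamGQ : ℝ := opNorm (piJoint p η S) (kernelRev p η S)

/-- The quantity `ε₀`. -/
def eps0 (i : Fin P) (T : ℕ) : ℝ :=
  P / (PIP p i * (∑ γ, piMarg p η γ * phiHat p η γ) * S) *
    Real.sqrt (64 * Real.exp 1 * Real.log T / ((1 - lamGQ p η S) * T))

/-- The upper bound for the mean-squared error. -/
def errBound (i : Fin P) (T : ℕ) : ℝ :=
  4 * eps0 p η S i T ^ 2 / (1 - eps0 p η S i T) ^ 2 * PIP p i ^ 2 +
    4 * P / S * (1 / ((⨅ γ, piMarg p η γ) * T))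

end Estimator

end VCwTGS

end

open VCwTGS

/-!
The estimator is a ratio of two empirical averages along the chain, of `φ̂(γ) Q` and of
`φ̂(γ) Q p(γ_i = 1 | γ_{-i})`. Since `π φ⁻¹` is proportional to `p`, their stationary means are
`A = (S / P) E_π[φ̂]` and `A · PIP(i)`. When both averages are within `δ = ε₀ PIP(i) A` of their means
the ratio is within `2 ε₀ PIP(i) / (1 - ε₀)` of `PIP(i)` (`abs_div_sub_sq_le`); otherwise the squared
error is at most `1`. It remains to bound the probability of a deviation by `P / (S min π T)` for each
of the four one-sided events, which is a Chernoff bound with exponent `δ² (1 - λ) T / 64`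
(`measure_sum_ge_le`): at this `δ` the exponential is `T ^ (-e)`,
which for `T ≥ 2` absorbs the prefactor `2`; for `T = 1` the claimed bound exceeds `1`.

The initial law has density at most `P / (S min π)` with respect to the stationary one, so the chain may
be started at stationarity. By the Markov property the moment generating function of an additive
functional is an iterate of the kernel multiplied by `e^{θ g}` (`IsMarkovChain.integral_prod`). For both
kernels this iterate acts on functions of `γ` alone, and there it has the common form
`s F D₁ + (1 - s) D₀` (`tilted`), where `s = S / P`, `F` flips a coordinate drawn from `f(· | γ)`, and
`D₁`, `D₀` are positive functions close to `1` with `E_π[s D₁ + (1 - s) D₀] ≤ 1 + θ²`. For the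
reversible kernel `K` both factors are the average of `e^{θ g}` over `Q`; for the sampler read literally
they are the values of `e^{θ g}` at `Q = 1` and `Q = 0`. Hence one estimate serves both chains, although
`λ` is defined through `K` only.

The tilted kernel is symmetric with respect to the weight `π D₁` and has nonnegative entries, so its norm
is the maximum of its quadratic form (`sum_act_sq_le`). The spectral gap, rewritten as
`s ⟨u, F u⟩ ≤ (1 - λ) (E_π u)² + (s - (1 - λ)) E_π u²` (`flipKernel_gap`), reduces the quadratic form to
a rank-one perturbation of a multiplication operator. A weighted Cauchy-Schwarz inequality bounds that
by `1 + 16 θ² / (1 - λ)` (`quadForm_tilted_le`, `sum_iterate_tilted_le`).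

All of this needs `λ < 1` (`lamGQ_lt_one`). The norm is attained, by compactness, and at a
maximizer of norm `1` Jensen's inequality would be an equality in every row of `K`. As `K` both stays
and flips every coordinate with positive probability, the maximizer would be constant, hence annihilated
by `K - E_π`. Finally, the posterior is positive because the marginal likelihood is finite: the
likelihood is at most `σ^(-N)`, and `σ^(-2)` has a gamma distribution, which has all moments.
-/

noncomputable section

namespace VCwTGS

/-! ### Positivity and normalization of the posterior -/

theorem gaussianPDF_le (m : ℝ) (v : NNReal) (x : ℝ) :
    gaussianPDF m v x ≤ ENNReal.ofReal (√(2 * Real.pi * v))⁻¹ := by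
  refine ENNReal.ofReal_le_ofReal ?_
  rw [gaussianPDFReal_def]
  refine mul_le_of_le_one_right (by positivity) (Real.exp_le_one_iff.2 ?_)
  rw [neg_div]
  exact neg_nonpos.2 (by positivity)

theorem lintegral_prod_gaussianPDF {ι : Type*} [Fintype ι] {v : NNReal} (hv : v ≠ 0) :
    ∫⁻ β : ι → ℝ, ∏ j, gaussianPDF 0 v (β j) = 1 := by
  have h1 : ∀ β : ι → ℝ, ∏ j, gaussianPDF 0 v (β j)
      = ENNReal.ofReal (∏ j, gaussianPDFReal 0 v (β j)) := fun β => by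
    rw [ENNReal.ofReal_prod_of_nonneg fun j _ => gaussianPDFReal_nonneg _ _ _]; rfl
  simp_rw [h1]
  have hint : Integrable (fun β : ι → ℝ => ∏ j, gaussianPDFReal 0 v (β j)) :=
    Integrable.fintype_prod (f := fun _ => gaussianPDFReal 0 v)
      fun _ => integrable_gaussianPDFReal 0 v
  rw [← ofReal_integral_eq_lintegral_ofReal hint
    (ae_of_all _ fun β => Finset.prod_nonneg fun j _ => gaussianPDFReal_nonneg _ _ _),
    integral_fintype_prod_volume_eq_pow (gaussianPDFReal 0 v),
    integral_gaussianPDFReal_eq_one 0 hv]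
  simp

theorem measurable_gammaPDF (a r : ℝ) : Measurable (gammaPDF a r) :=
  (measurable_gammaPDFReal a r).ennreal_ofReal

theorem ae_pos_gammaMeasure (a r : ℝ) : ∀ᵐ x ∂(gammaMeasure a r), 0 < x := by
  have hae : ∀ᵐ x : ℝ, x ≠ 0 := by simp [ae_iff]
  rw [gammaMeasure, ae_withDensity_iff (measurable_gammaPDF a r)]
  filter_upwards [hae] with x hx h
  by_contra hneg
  exact h (gammaPDF_of_neg (lt_of_le_of_ne (not_lt.1 hneg) hx))

/-- The moments of nonnegative order of a gamma distribution are finite: a power multiplies the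
density into a constant multiple of another gamma density. -/
theorem lintegral_rpow_gammaMeasure_lt_top {a r c : ℝ} (ha : 0 < a) (hr : 0 < r) (hc : 0 ≤ c) :
    ∫⁻ x, ENNReal.ofReal (x ^ c) ∂(gammaMeasure a r) < ⊤ := by
  have hm : Measurable fun x : ℝ => ENNReal.ofReal (x ^ c) := by fun_prop
  rw [gammaMeasure,
    lintegral_withDensity_eq_lintegral_mul _ (measurable_gammaPDF a r) hm]
  set C := r ^ a * Real.Gamma (a + c) / (Real.Gamma a * r ^ (a + c))
  have hΓ := Real.Gamma_pos_of_pos ha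
  have hΓ' := Real.Gamma_pos_of_pos (add_pos_of_pos_of_nonneg ha hc)
  have hC : 0 ≤ C := by positivity
  have hae : ∀ᵐ x : ℝ, x ≠ 0 := by simp [ae_iff]
  calc _ = ∫⁻ x, ENNReal.ofReal C * gammaPDF (a + c) r x := by
        refine lintegral_congr_ae ?_
        filter_upwards [hae] with x hx
        rcases lt_or_gt_of_ne hx with h | h
        · simp [gammaPDF_of_neg h]
        · rw [Pi.mul_apply, gammaPDF_of_nonneg h.le, gammaPDF_of_nonneg h.le,
            ← ENNReal.ofReal_mul (by positivity), ← ENNReal.ofReal_mul hC]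
          congr 1
          rw [show a + c - 1 = (a - 1) + c by ring, Real.rpow_add h]
          simp only [C]
          field_simp
    _ = ENNReal.ofReal C := by
        rw [lintegral_const_mul _ (measurable_gammaPDF _ r),
          lintegral_gammaPDF_eq_one (by positivity) hr, mul_one]
    _ < ⊤ := ENNReal.ofReal_lt_top

namespace BVS

variable {P N : ℕ} (M : BVS P N)

/-- The density of `(β_γ, Y)` given `σ² = s`, the integrand of the marginal likelihood. -/
def jointDensity (γ : Incl P) (s : ℝ) (β : {j : Fin P // γ j = true} → ℝ) : ENNReal :=
  (∏ j, gaussianPDF 0 (s / M.τ).toNNReal (β j)) *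
    ∏ n, gaussianPDF (∑ j, β j * M.X n j.1) s.toNNReal (M.Y n)

theorem measurable_jointDensity (γ : Incl P) :
    Measurable (Function.uncurry (M.jointDensity γ)) := by
  unfold jointDensity Function.uncurry
  refine Measurable.mul (Finset.measurable_prod _ fun j _ => ?_)
    (Finset.measurable_prod _ fun n _ => ?_)
  · exact measurable_uncurry_gaussianPDF.comp
      (f := fun p : ℝ × ({j : Fin P // γ j = true} → ℝ) => ((0 : ℝ), (p.1 / M.τ).toNNReal, p.2 j))
      (by fun_prop)
  · exact measurable_uncurry_gaussianPDF.comp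
      (f := fun p : ℝ × ({j : Fin P // γ j = true} → ℝ) =>
        (∑ j, p.2 j * M.X n j.1, p.1.toNNReal, M.Y n)) (by fun_prop)

theorem measurable_lintegral_jointDensity (γ : Incl P) :
    Measurable fun s => ∫⁻ β, M.jointDensity γ s β :=
  Measurable.lintegral_prod_right' (ν := volume) (M.measurable_jointDensity γ)

theorem marginalLikelihood_eq (γ : Incl P) :
    M.marginalLikelihood γ = ∫⁻ x, (∫⁻ β, M.jointDensity γ x⁻¹ β)
      ∂(gammaMeasure (M.ν₀ / 2) (M.ν₀ * M.lam₀ / 2)) :=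
  lintegral_map (M.measurable_lintegral_jointDensity γ) measurable_inv

theorem lintegral_jointDensity_ne_zero (γ : Incl P) {s : ℝ} (hs : 0 < s) :
    ∫⁻ β, M.jointDensity γ s β ≠ 0 := by
  intro h0
  have hm : Measurable (M.jointDensity γ s) :=
    (M.measurable_jointDensity γ).of_uncurry_left
  rw [lintegral_eq_zero_iff hm] at h0
  obtain ⟨β, hβ⟩ := h0.exists
  have hτ := M.τ_pos
  have hv1 : (s / M.τ).toNNReal ≠ 0 := (Real.toNNReal_pos.2 (by positivity)).ne'
  have hv2 : s.toNNReal ≠ 0 := (Real.toNNReal_pos.2 (by positivity)).ne'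
  refine (mul_ne_zero (Finset.prod_ne_zero_iff.2 fun j _ => ?_)
    (Finset.prod_ne_zero_iff.2 fun n _ => ?_)) hβ
  · exact (gaussianPDF_pos _ hv1 _).ne'
  · exact (gaussianPDF_pos _ hv2 _).ne'

theorem marginalLikelihood_ne_zero (γ : Incl P) : M.marginalLikelihood γ ≠ 0 := by
  have hν := M.ν₀_pos
  have hl := M.lam₀_pos
  have hprob := isProbabilityMeasure_gammaMeasure (a := M.ν₀ / 2) (r := M.ν₀ * M.lam₀ / 2)
    (by positivity) (by positivity)
  have hm : Measurable fun x : ℝ => ∫⁻ β, M.jointDensity γ x⁻¹ β :=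
    (M.measurable_lintegral_jointDensity γ).comp measurable_inv
  rw [marginalLikelihood_eq]
  intro h0
  rw [lintegral_eq_zero_iff hm] at h0
  obtain ⟨x, hx, hpos⟩ := (h0.and (ae_pos_gammaMeasure _ _)).exists
  exact M.lintegral_jointDensity_ne_zero γ (inv_pos.2 hpos) hx

theorem marginalLikelihood_ne_top (γ : Incl P) : M.marginalLikelihood γ ≠ ⊤ := by
  have hν := M.ν₀_pos
  have hl := M.lam₀_pos
  have hτ := M.τ_pos
  rw [marginalLikelihood_eq]
  refine (lt_of_le_of_lt ?_ (lintegral_rpow_gammaMeasure_lt_top (a := M.ν₀ / 2)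
    (r := M.ν₀ * M.lam₀ / 2) (c := (N : ℝ) / 2) (by positivity) (by positivity)
    (by positivity))).ne
  refine lintegral_mono_ae ?_
  filter_upwards [ae_pos_gammaMeasure _ _] with x hx
  have hv1 : (x⁻¹ / M.τ).toNNReal ≠ 0 := (Real.toNNReal_pos.2 (by positivity)).ne'
  have hsq : (√(2 * Real.pi * x⁻¹))⁻¹ ≤ √x := by
    rw [← Real.sqrt_inv]
    refine Real.sqrt_le_sqrt ?_
    rw [mul_inv, inv_inv]
    exact mul_le_of_le_one_left hx.le (inv_le_one_of_one_le₀ (by linarith [Real.pi_gt_three]))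
  have hb : ∀ β, M.jointDensity γ x⁻¹ β ≤
      (∏ j, gaussianPDF 0 (x⁻¹ / M.τ).toNNReal (β j)) * ENNReal.ofReal (x ^ ((N : ℝ) / 2)) := by
    intro β
    refine mul_le_mul_right ?_ _
    calc _ ≤ ∏ _n : Fin N, ENNReal.ofReal √x := by
          refine Finset.prod_le_prod' fun n _ => (gaussianPDF_le _ _ _).trans ?_
          rw [Real.coe_toNNReal _ (by positivity)]
          exact ENNReal.ofReal_le_ofReal hsq
      _ = _ := by
          rw [Finset.prod_const, Finset.card_univ, Fintype.card_fin,
            ← ENNReal.ofReal_pow (by positivity), Real.sqrt_eq_rpow, ← Real.rpow_natCast,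
            ← Real.rpow_mul hx.le]
          congr 2
          ring
  refine (lintegral_mono hb).trans ?_
  rw [lintegral_mul_const', lintegral_prod_gaussianPDF hv1, one_mul]
  exact ENNReal.ofReal_ne_top

theorem prior_pos (γ : Incl P) : 0 < M.prior γ := by
  refine Finset.prod_pos fun j _ => ?_
  split_ifs
  · exact M.h_pos
  · exact sub_pos.2 M.h_lt_one

theorem prior_mul_marginalLikelihood_ne_top (γ : Incl P) :
    ENNReal.ofReal (M.prior γ) * M.marginalLikelihood γ ≠ ⊤ :=
  ENNReal.mul_ne_top ENNReal.ofReal_ne_top (M.marginalLikelihood_ne_top γ)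

theorem prior_mul_marginalLikelihood_ne_zero (γ : Incl P) :
    ENNReal.ofReal (M.prior γ) * M.marginalLikelihood γ ≠ 0 :=
  mul_ne_zero (ENNReal.ofReal_pos.2 (M.prior_pos γ)).ne' (M.marginalLikelihood_ne_zero γ)

theorem evidence_ne_top :
    ∑ γ', ENNReal.ofReal (M.prior γ') * M.marginalLikelihood γ' ≠ ⊤ :=
  ENNReal.sum_ne_top.2 fun γ _ => M.prior_mul_marginalLikelihood_ne_top γ

theorem evidence_ne_zero :
    ∑ γ', ENNReal.ofReal (M.prior γ') * M.marginalLikelihood γ' ≠ 0 := fun h =>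
  M.prior_mul_marginalLikelihood_ne_zero (fun _ => true)
    (Finset.sum_eq_zero_iff.1 h _ (Finset.mem_univ _))

theorem posterior_pos (γ : Incl P) : 0 < M.posterior γ :=
  ENNReal.toReal_pos
    (ENNReal.div_ne_zero.2 ⟨M.prior_mul_marginalLikelihood_ne_zero γ, M.evidence_ne_top⟩)
    (ENNReal.div_ne_top (M.prior_mul_marginalLikelihood_ne_top γ) M.evidence_ne_zero)

theorem sum_posterior : ∑ γ, M.posterior γ = 1 := by
  unfold posterior
  rw [← ENNReal.toReal_sum fun γ _ =>
    ENNReal.div_ne_top (M.prior_mul_marginalLikelihood_ne_top γ) M.evidence_ne_zero]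
  simp_rw [div_eq_mul_inv]
  rw [← Finset.sum_mul, ENNReal.mul_inv_cancel M.evidence_ne_zero M.evidence_ne_top,
    ENNReal.toReal_one]

end BVS

/-! ### Tilted kernels on a finite state space -/

section Tilted

variable {Γ : Type*} [Fintype Γ]

/-- The action `(A v)(x) = ∑ y, A x y * v y` of a kernel on functions. -/
def act (A : Γ → Γ → ℝ) (v : Γ → ℝ) (x : Γ) : ℝ := ∑ y, A x y * v y

theorem act_nonneg {A : Γ → Γ → ℝ} (hA : ∀ x y, 0 ≤ A x y) {v : Γ → ℝ} (hv : ∀ x, 0 ≤ v x) (x : Γ) :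
    0 ≤ act A v x :=
  Finset.sum_nonneg fun y _ => mul_nonneg (hA x y) (hv y)

theorem iterate_act_nonneg {A : Γ → Γ → ℝ} (hA : ∀ x y, 0 ≤ A x y) {v : Γ → ℝ}
    (hv : ∀ x, 0 ≤ v x) (n : ℕ) (x : Γ) : 0 ≤ (act A)^[n] v x := by
  induction n generalizing x with
  | zero => exact hv x
  | succ n ih =>
    rw [Function.iterate_succ_apply']
    exact act_nonneg hA ih x

/-- The bilinear form of a kernel that is symmetric with respect to the weight `ω`. -/
theorem sum_mul_act_comm {ω : Γ → ℝ} {A : Γ → Γ → ℝ} (hsym : ∀ x y, ω x * A x y = ω y * A y x)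
    (a b : Γ → ℝ) : ∑ x, ω x * (a x * act A b x) = ∑ x, ω x * (b x * act A a x) := by
  simp only [act, Finset.mul_sum]
  rw [Finset.sum_comm]
  refine Finset.sum_congr rfl fun y _ => Finset.sum_congr rfl fun x _ => ?_
  linear_combination (a x * b y) * hsym x y

theorem act_add (A : Γ → Γ → ℝ) (a b : Γ → ℝ) (x : Γ) :
    act A (fun y => a y + b y) x = act A a x + act A b x := by
  simp only [act, mul_add, Finset.sum_add_distrib]

theorem act_sub (A : Γ → Γ → ℝ) (a b : Γ → ℝ) (x : Γ) :
    act A (fun y => a y - b y) x = act A a x - act A b x := by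
  simp only [act, mul_sub, Finset.sum_sub_distrib]

theorem act_const_mul (A : Γ → Γ → ℝ) (c : ℝ) (b : Γ → ℝ) (x : Γ) :
    act A (fun y => c * b y) x = c * act A b x := by
  simp only [act, Finset.mul_sum]
  exact Finset.sum_congr rfl fun y _ => by ring

/-- For a symmetric kernel with nonnegative entries an upper bound for the quadratic form is a bound
for the operator norm: the quadratic form at `b` is at least minus the one at `|b|`, and polarization
at `A b ± ρ b` does the rest. -/
theorem sum_act_sq_le {ω : Γ → ℝ} {A : Γ → Γ → ℝ} {ρ : ℝ} (hω : ∀ x, 0 ≤ ω x)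
    (hA : ∀ x y, 0 ≤ A x y) (hsym : ∀ x y, ω x * A x y = ω y * A y x) (hρ : 0 < ρ)
    (hq : ∀ b : Γ → ℝ, ∑ x, ω x * (b x * act A b x) ≤ ρ * ∑ x, ω x * b x ^ 2) (b : Γ → ℝ) :
    ∑ x, ω x * act A b x ^ 2 ≤ ρ ^ 2 * ∑ x, ω x * b x ^ 2 := by
  -- lower bound for the quadratic form, by comparison with `|b|`
  have hq' : ∀ b : Γ → ℝ, -(ρ * ∑ x, ω x * b x ^ 2) ≤ ∑ x, ω x * (b x * act A b x) := by
    intro b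
    have h := hq fun x => |b x|
    simp only [sq_abs] at h
    refine (neg_le_neg h).trans ?_
    rw [← Finset.sum_neg_distrib]
    refine Finset.sum_le_sum fun x _ => ?_
    rw [← mul_neg]
    refine mul_le_mul_of_nonneg_left ?_ (hω x)
    have h2 : |b x * act A b x| ≤ |b x| * act A (fun y => |b y|) x := by
      rw [abs_mul]
      refine mul_le_mul_of_nonneg_left ?_ (abs_nonneg _)
      refine (Finset.abs_sum_le_sum_abs _ _).trans (Finset.sum_le_sum fun y _ => ?_)
      rw [abs_mul, abs_of_nonneg (hA x y)]
    exact (neg_le_neg h2).trans (neg_abs_le _)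
  set a := act A b with ha
  have hp := hq fun x => a x + ρ * b x
  have hm := hq' fun x => a x - ρ * b x
  have hc := sum_mul_act_comm hsym a b
  have e1 : ∑ x, ω x * ((a x + ρ * b x) * act A (fun x => a x + ρ * b x) x)
      - ∑ x, ω x * ((a x - ρ * b x) * act A (fun x => a x - ρ * b x) x)
      = 4 * ρ * ∑ x, ω x * a x ^ 2 := by
    have : 4 * ρ * ∑ x, ω x * a x ^ 2 = 2 * ρ * ∑ x, ω x * (a x * act A b x)
        + 2 * ρ * ∑ x, ω x * (b x * act A a x) := by
      rw [← hc, ← ha]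
      simp only [pow_two]
      ring
    rw [this]
    simp only [act_add A a fun x => ρ * b x, act_sub A a fun x => ρ * b x, act_const_mul]
    rw [Finset.mul_sum, Finset.mul_sum, ← Finset.sum_sub_distrib, ← Finset.sum_add_distrib]
    exact Finset.sum_congr rfl fun x _ => by ring
  have e2 : ∑ x, ω x * (a x + ρ * b x) ^ 2 + ∑ x, ω x * (a x - ρ * b x) ^ 2
      = 2 * ∑ x, ω x * a x ^ 2 + 2 * ρ ^ 2 * ∑ x, ω x * b x ^ 2 := by
    rw [Finset.mul_sum, Finset.mul_sum, ← Finset.sum_add_distrib, ← Finset.sum_add_distrib]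
    exact Finset.sum_congr rfl fun x _ => by ring
  have h3 : 4 * ρ * ∑ x, ω x * a x ^ 2
      ≤ ρ * (2 * ∑ x, ω x * a x ^ 2 + 2 * ρ ^ 2 * ∑ x, ω x * b x ^ 2) := by
    rw [← e1, ← e2]
    linarith
  have h4 : ρ * (4 * ∑ x, ω x * a x ^ 2)
      ≤ ρ * (2 * ∑ x, ω x * a x ^ 2 + 2 * ρ ^ 2 * ∑ x, ω x * b x ^ 2) := by linarith
  linarith [le_of_mul_le_mul_left h4 hρ]

theorem sum_iterate_act_le {ω : Γ → ℝ} {A : Γ → Γ → ℝ} {ρ : ℝ} (hω : ∀ x, 0 ≤ ω x)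
    (hA : ∀ x y, 0 ≤ A x y) (hsym : ∀ x y, ω x * A x y = ω y * A y x) (hρ : 0 < ρ)
    (hq : ∀ b : Γ → ℝ, ∑ x, ω x * (b x * act A b x) ≤ ρ * ∑ x, ω x * b x ^ 2) (n : ℕ) :
    ∑ x, ω x * (act A)^[n] 1 x ≤ ρ ^ n * ∑ x, ω x := by
  have hsq : ∑ x, ω x * (act A)^[n] 1 x ^ 2 ≤ (ρ ^ n) ^ 2 * ∑ x, ω x := by
    induction n with
    | zero => simp
    | succ n ih =>
      rw [Function.iterate_succ_apply']
      refine (sum_act_sq_le hω hA hsym hρ hq _).trans ?_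
      calc _ ≤ ρ ^ 2 * ((ρ ^ n) ^ 2 * ∑ x, ω x) := mul_le_mul_of_nonneg_left ih (sq_nonneg ρ)
        _ = _ := by ring
  have hW : 0 ≤ ∑ x, ω x := Finset.sum_nonneg fun x _ => hω x
  refine le_of_sq_le_sq ?_ (by positivity)
  calc (∑ x, ω x * (act A)^[n] 1 x) ^ 2
      ≤ (∑ x, ω x) * ∑ x, ω x * (act A)^[n] 1 x ^ 2 :=
        Finset.sum_sq_le_sum_mul_sum_of_sq_le_mul _ (fun x _ => hω x)
          (fun x _ => mul_nonneg (hω x) (sq_nonneg _)) fun x _ => le_of_eq (by ring)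
    _ ≤ (∑ x, ω x) * ((ρ ^ n) ^ 2 * ∑ x, ω x) := mul_le_mul_of_nonneg_left hsq hW
    _ = _ := by ring

theorem inv_one_add_le {U : ℝ} (hU : -(1 / 2) ≤ U) : (1 + U)⁻¹ ≤ 1 - U + 2 * U ^ 2 := by
  rw [inv_le_iff_one_le_mul₀ (by linarith)]
  nlinarith [mul_nonneg (sq_nonneg U) (by linarith : 0 ≤ 1 + 2 * U)]

/-- The kernel `s F D₁ + (1 - s) D₀`: with probability `s` move by `F` and collect the factor `D₁`,
with probability `1 - s` stay and collect the factor `D₀`. -/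
def tilted [DecidableEq Γ] (s : ℝ) (F : Γ → Γ → ℝ) (D₁ D₀ : Γ → ℝ) (x y : Γ) : ℝ :=
  s * (F x y * D₁ y) + (1 - s) * (if y = x then D₀ y else 0)

theorem act_tilted [DecidableEq Γ] (s : ℝ) (F : Γ → Γ → ℝ) (D₁ D₀ v : Γ → ℝ) (x : Γ) :
    act (tilted s F D₁ D₀) v x = s * act F (fun y => D₁ y * v y) x + (1 - s) * (D₀ x * v x) := by
  simp only [act, tilted, add_mul, Finset.sum_add_distrib, Finset.mul_sum]
  congr 1
  · exact Finset.sum_congr rfl fun y _ => by ring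
  · simp [mul_assoc]

/-- A spectral gap of `F` bounds the quadratic form of the tilted kernel. With `u = D₁ b` the rank one
term `κ (E u)²` is absorbed by the Cauchy-Schwarz inequality with the weight `1 + U`; this needs
`E (1 + U)⁻¹ ≤ 1`, which the mean of `U - 2 U²` controls. -/
theorem quadForm_tilted_le [DecidableEq Γ] {π D₁ D₀ U : Γ → ℝ} {F : Γ → Γ → ℝ} {s κ ρ : ℝ}
    (hπ : ∀ x, 0 ≤ π x) (hπ1 : ∑ x, π x = 1) (hκ : 0 < κ) (hD : ∀ x, 0 < D₁ x)
    (hgap : ∀ u : Γ → ℝ, s * ∑ x, π x * (u x * act F u x)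
      ≤ κ * (∑ x, π x * u x) ^ 2 + (s - κ) * ∑ x, π x * u x ^ 2)
    (hU : ∀ x, -(1 / 2) ≤ U x) (hUD : ∀ x, s + κ * U x ≤ (ρ - (1 - s) * D₀ x) / D₁ x)
    (hmean : 0 ≤ ∑ x, π x * (U x - 2 * U x ^ 2)) (b : Γ → ℝ) :
    ∑ x, (π x * D₁ x) * (b x * act (tilted s F D₁ D₀) b x)
      ≤ ρ * ∑ x, (π x * D₁ x) * b x ^ 2 := by
  set u : Γ → ℝ := fun x => D₁ x * b x
  have hU' : ∀ x, 0 < 1 + U x := fun x => by linarith [hU x]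
  have hinv : ∑ x, π x * (1 + U x)⁻¹ ≤ 1 := by
    calc ∑ x, π x * (1 + U x)⁻¹ ≤ ∑ x, (π x - π x * (U x - 2 * U x ^ 2)) :=
          Finset.sum_le_sum fun x _ => by
            have := mul_le_mul_of_nonneg_left (inv_one_add_le (hU x)) (hπ x)
            linarith
      _ ≤ 1 := by rw [Finset.sum_sub_distrib, hπ1]; linarith
  have hS : 0 ≤ ∑ x, π x * ((1 + U x) * u x ^ 2) :=
    Finset.sum_nonneg fun x _ => mul_nonneg (hπ x) (mul_nonneg (hU' x).le (sq_nonneg _))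
  have hcs : (∑ x, π x * u x) ^ 2 ≤ ∑ x, π x * ((1 + U x) * u x ^ 2) := by
    calc (∑ x, π x * u x) ^ 2
        ≤ (∑ x, π x * (1 + U x)⁻¹) * ∑ x, π x * ((1 + U x) * u x ^ 2) := by
          refine Finset.sum_sq_le_sum_mul_sum_of_sq_le_mul _
            (fun x _ => mul_nonneg (hπ x) (inv_nonneg.2 (hU' x).le))
            (fun x _ => mul_nonneg (hπ x) (mul_nonneg (hU' x).le (sq_nonneg _))) fun x _ => ?_
          have := (hU' x).ne'
          exact le_of_eq (by field_simp)
      _ ≤ 1 * ∑ x, π x * ((1 + U x) * u x ^ 2) := mul_le_mul_of_nonneg_right hinv hS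
      _ = _ := one_mul _
  calc ∑ x, (π x * D₁ x) * (b x * act (tilted s F D₁ D₀) b x)
      = s * ∑ x, π x * (u x * act F u x) + ∑ x, π x * ((1 - s) * (D₀ x * D₁ x * b x ^ 2)) := by
        rw [Finset.mul_sum, ← Finset.sum_add_distrib]
        refine Finset.sum_congr rfl fun x _ => ?_
        rw [act_tilted]
        simp only [u]
        ring
    _ ≤ (κ * ∑ x, π x * ((1 + U x) * u x ^ 2) + (s - κ) * ∑ x, π x * u x ^ 2)
        + ∑ x, π x * ((1 - s) * (D₀ x * D₁ x * b x ^ 2)) := by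
        have h1 := hgap u
        have h2 := mul_le_mul_of_nonneg_left hcs hκ.le
        linarith
    _ = ∑ x, π x * ((s + κ * U x) * u x ^ 2 + (1 - s) * (D₀ x * D₁ x * b x ^ 2)) := by
        rw [Finset.mul_sum, Finset.mul_sum, ← Finset.sum_add_distrib, ← Finset.sum_add_distrib]
        exact Finset.sum_congr rfl fun x _ => by ring
    _ ≤ ∑ x, ρ * ((π x * D₁ x) * b x ^ 2) := by
        refine Finset.sum_le_sum fun x _ => ?_
        have h1 := mul_le_mul_of_nonneg_right (hUD x) (sq_nonneg (u x))
        have h2 : (ρ - (1 - s) * D₀ x) / D₁ x * u x ^ 2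
            = (ρ - (1 - s) * D₀ x) * D₁ x * b x ^ 2 := by
          have := (hD x).ne'
          simp only [u]
          field_simp
        rw [h2] at h1
        have h3 := mul_le_mul_of_nonneg_left h1 (hπ x)
        linarith
    _ = _ := by rw [Finset.mul_sum]

/-- The pointwise inequality between the tilting factors and the weight `U` of
`quadForm_tilted_le`. -/
theorem tilting_factor_bound {s κ θ r d₁ d₀ : ℝ} (hs0 : 0 ≤ s) (hs1 : s ≤ 1) (hκ1 : κ ≤ 1)
    (hθ0 : 0 ≤ θ) (hθ : θ ≤ κ / 32) (hr0 : 0 ≤ r) (h1 : |d₁| ≤ 11 / 10 * θ)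
    (h0 : |d₀| ≤ 11 / 10 * θ) :
    s + (r - 11 / 10 * θ * r - 4 * θ ^ 2 - (s * d₁ + (1 - s) * d₀))
      ≤ (1 + r - (1 - s) * (1 + d₀)) / (1 + d₁) := by
  obtain ⟨h1a, h1b⟩ := abs_le.1 h1
  obtain ⟨h0a, h0b⟩ := abs_le.1 h0
  have hθ' : θ ≤ 1 / 32 := by linarith
  have hD : 9 / 10 ≤ 1 + d₁ := by linarith
  have hs1' : 0 ≤ 1 - s := by linarith
  have hd1 : d₁ ^ 2 ≤ 121 / 100 * θ ^ 2 := by nlinarith [sq_abs d₁, abs_nonneg d₁]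
  have hd10 : |d₁ * d₀| ≤ 121 / 100 * θ ^ 2 := by
    rw [abs_mul]
    nlinarith [abs_nonneg d₁, abs_nonneg d₀]
  have hd10' : -(121 / 100 * θ ^ 2) ≤ (1 - s) * (d₁ * d₀) := by
    have h2 := (abs_le.1 hd10).1
    nlinarith [sq_nonneg θ]
  have hrd : r * d₁ ≤ 11 / 10 * θ * r := by nlinarith
  have hX : -1 ≤ s + r - (1 - s) * d₀ := by nlinarith
  have hq0 : 0 ≤ d₁ ^ 2 / (1 + d₁) := by positivity
  have hq : d₁ ^ 2 / (1 + d₁) ≤ 2 * θ ^ 2 := by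
    rw [div_le_iff₀ (by linarith)]
    nlinarith [sq_nonneg θ]
  -- `1 / (1 + d₁) = 1 - d₁ + d₁² / (1 + d₁)`
  have hsplit : (1 + r - (1 - s) * (1 + d₀)) / (1 + d₁)
      = (s + r - (1 - s) * d₀) * (1 - d₁) + (s + r - (1 - s) * d₀) * (d₁ ^ 2 / (1 + d₁)) := by
    have : 1 + d₁ ≠ 0 := by linarith
    field_simp
    ring
  have herr : -(2 * θ ^ 2) ≤ (s + r - (1 - s) * d₀) * (d₁ ^ 2 / (1 + d₁)) := by nlinarith
  rw [hsplit]
  nlinarith [sq_nonneg θ]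

/-- Growth of the moment generating function along a path of the tilted kernel, started from `π` with
initial factor `ψ`. The bound `11 / 10 * θ` is what `|e^x - 1|` satisfies for `|x| ≤ θ ≤ 1 / 32`; the
weight of `quadForm_tilted_le` is `U = (a - ℓ) / κ`, with `ℓ` the first-order part of the tilt and `a`
the growth rate `r = 16 θ² / κ` less the second-order errors. -/
theorem sum_iterate_tilted_le [DecidableEq Γ] {π D₁ D₀ ψ : Γ → ℝ} {F : Γ → Γ → ℝ} {s κ θ : ℝ}
    (hπ : ∀ x, 0 ≤ π x) (hπ1 : ∑ x, π x = 1) (hF : ∀ x y, 0 ≤ F x y)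
    (hrev : ∀ x y, π x * F x y = π y * F y x) (hs0 : 0 ≤ s) (hs1 : s ≤ 1)
    (hκ : 0 < κ) (hκ1 : κ ≤ 1) (hθ0 : 0 ≤ θ) (hθ : θ ≤ κ / 32)
    (hgap : ∀ u : Γ → ℝ, s * ∑ x, π x * (u x * act F u x)
      ≤ κ * (∑ x, π x * u x) ^ 2 + (s - κ) * ∑ x, π x * u x ^ 2)
    (hD₁ : ∀ x, |D₁ x - 1| ≤ 11 / 10 * θ) (hD₀ : ∀ x, |D₀ x - 1| ≤ 11 / 10 * θ)
    (hψ : ∀ x, |ψ x - 1| ≤ 11 / 10 * θ)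
    (hmean : ∑ x, π x * (s * D₁ x + (1 - s) * D₀ x) ≤ 1 + θ ^ 2) (n : ℕ) :
    ∑ x, π x * (ψ x * (act (tilted s F D₁ D₀))^[n] 1 x) ≤ 2 * (1 + 16 * θ ^ 2 / κ) ^ n := by
  set r := 16 * θ ^ 2 / κ with hr
  have hrκ : r * κ = 16 * θ ^ 2 := by rw [hr]; field_simp
  have hr0 : 0 ≤ r := by positivity
  have hθ' : θ ≤ 1 / 32 := by linarith
  have hrθ : r ≤ θ / 2 := by
    rw [hr, div_le_iff₀ hκ]
    nlinarith
  have hD₁pos : ∀ x, 9 / 10 ≤ D₁ x := fun x => by linarith [(abs_le.1 (hD₁ x)).1]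
  have hD₀pos : ∀ x, 9 / 10 ≤ D₀ x := fun x => by linarith [(abs_le.1 (hD₀ x)).1]
  have hA : ∀ x y, 0 ≤ tilted s F D₁ D₀ x y := by
    intro x y
    refine add_nonneg (mul_nonneg hs0 (mul_nonneg (hF x y) (by linarith [hD₁pos y])))
      (mul_nonneg (by linarith) ?_)
    split_ifs
    · linarith [hD₀pos y]
    · exact le_rfl
  set ω : Γ → ℝ := fun x => π x * D₁ x with hω
  have hω0 : ∀ x, 0 ≤ ω x := fun x => mul_nonneg (hπ x) (by linarith [hD₁pos x])
  have hsym : ∀ x y, ω x * tilted s F D₁ D₀ x y = ω y * tilted s F D₁ D₀ y x := by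
    intro x y
    simp only [hω, tilted]
    by_cases hxy : y = x
    · subst hxy; rfl
    · rw [if_neg hxy, if_neg fun h => hxy h.symm]
      linear_combination (s * D₁ x * D₁ y) * hrev x y
  set a := r - 11 / 10 * θ * r - 4 * θ ^ 2 with ha
  set ℓ : Γ → ℝ := fun x => s * (D₁ x - 1) + (1 - s) * (D₀ x - 1) with hℓ
  have hℓabs : ∀ x, |ℓ x| ≤ 11 / 10 * θ := by
    intro x
    obtain ⟨h1, h2⟩ := abs_le.1 (hD₁ x)
    obtain ⟨h3, h4⟩ := abs_le.1 (hD₀ x)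
    have hs1' : 0 ≤ 1 - s := by linarith
    rw [abs_le]
    simp only [hℓ]
    constructor <;> nlinarith
  have hℓmean : ∑ x, π x * ℓ x ≤ θ ^ 2 := by
    have : ∑ x, π x * ℓ x = ∑ x, π x * (s * D₁ x + (1 - s) * D₀ x) - ∑ x, π x := by
      rw [← Finset.sum_sub_distrib]
      exact Finset.sum_congr rfl fun x _ => by simp only [hℓ]; ring
    rw [this, hπ1]
    linarith
  have har : a ≤ r := by nlinarith [sq_nonneg θ, mul_nonneg hθ0 hr0]
  have haκ : 11 * θ ^ 2 ≤ a * κ := by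
    rw [ha]
    have h1 : (r - 11 / 10 * θ * r - 4 * θ ^ 2) * κ
        = 16 * θ ^ 2 * (1 - 11 / 10 * θ) - 4 * θ ^ 2 * κ := by
      linear_combination (1 - 11 / 10 * θ) * hrκ
    rw [h1]
    nlinarith [sq_nonneg θ]
  have ha0 : 0 ≤ a := by
    by_contra hneg
    nlinarith [sq_nonneg θ]
  have hasq : 4 * a ^ 2 ≤ θ ^ 2 := by nlinarith
  set U : Γ → ℝ := fun x => (a - ℓ x) / κ with hU
  have hκU : ∀ x, κ * U x = a - ℓ x := fun x => by simp only [hU]; field_simp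
  have hq := quadForm_tilted_le (U := U) (D₁ := D₁) (D₀ := D₀) (ρ := 1 + r) hπ hπ1 hκ
    (fun x => by linarith [hD₁pos x]) hgap
    (fun x => by
      simp only [hU]
      rw [le_div_iff₀ hκ]
      have := (abs_le.1 (hℓabs x)).2
      nlinarith)
    (fun x => by
      have h := tilting_factor_bound hs0 hs1 hκ1 hθ0 hθ hr0 (hD₁ x) (hD₀ x)
      rw [add_sub_cancel, add_sub_cancel] at h
      rw [hκU]
      exact h)
    (by
      have hpt : ∀ x, π x * ((a - ℓ x) / κ - (4 * a ^ 2 + 484 / 100 * θ ^ 2) / κ ^ 2)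
          ≤ π x * (U x - 2 * U x ^ 2) := by
        intro x
        refine mul_le_mul_of_nonneg_left (sub_le_sub_left ?_ _) (hπ x)
        simp only [hU]
        rw [div_pow, ← mul_div_assoc]
        refine div_le_div_of_nonneg_right ?_ (by positivity)
        have h1 : ℓ x ^ 2 ≤ 121 / 100 * θ ^ 2 := by
          have := sq_le_sq' (abs_le.1 (hℓabs x)).1 (abs_le.1 (hℓabs x)).2
          linarith
        nlinarith [sq_nonneg (a + ℓ x)]
      refine le_trans ?_ (Finset.sum_le_sum fun x _ => hpt x)
      have hsum : ∑ x, π x * ((a - ℓ x) / κ - (4 * a ^ 2 + 484 / 100 * θ ^ 2) / κ ^ 2)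
          = (a * κ - (∑ x, π x * ℓ x) * κ - (4 * a ^ 2 + 484 / 100 * θ ^ 2)) / κ ^ 2 := by
        have : ∀ x, π x * ((a - ℓ x) / κ - (4 * a ^ 2 + 484 / 100 * θ ^ 2) / κ ^ 2)
            = π x * (a / κ - (4 * a ^ 2 + 484 / 100 * θ ^ 2) / κ ^ 2) - (π x * ℓ x) * κ⁻¹ := by
          intro x; field_simp; ring
        simp_rw [this]
        rw [Finset.sum_sub_distrib, ← Finset.sum_mul, ← Finset.sum_mul, hπ1]
        field_simp
        ring
      rw [hsum]
      refine div_nonneg ?_ (by positivity)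
      nlinarith [sq_nonneg θ, mul_le_mul_of_nonneg_right hℓmean hκ.le])
  have hmain := sum_iterate_act_le hω0 hA hsym (by linarith) hq n
  have hωsum : ∑ x, ω x ≤ 11 / 10 := by
    calc ∑ x, ω x ≤ ∑ x, π x * (11 / 10) := Finset.sum_le_sum fun x _ =>
          mul_le_mul_of_nonneg_left (by linarith [(abs_le.1 (hD₁ x)).2]) (hπ x)
      _ = 11 / 10 := by rw [← Finset.sum_mul, hπ1, one_mul]
  have hpow : 0 ≤ (1 + r) ^ n := by positivity
  calc ∑ x, π x * (ψ x * (act (tilted s F D₁ D₀))^[n] 1 x)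
      ≤ ∑ x, 3 / 2 * (ω x * (act (tilted s F D₁ D₀))^[n] 1 x) := by
        refine Finset.sum_le_sum fun x _ => ?_
        have h1 := iterate_act_nonneg hA (v := 1) (fun _ => zero_le_one) n x
        have h2 : ψ x ≤ 3 / 2 * D₁ x := by linarith [(abs_le.1 (hψ x)).2, hD₁pos x]
        have h3 := mul_le_mul_of_nonneg_left (mul_le_mul_of_nonneg_right h2 h1) (hπ x)
        simp only [hω]
        linarith
    _ = 3 / 2 * ∑ x, ω x * (act (tilted s F D₁ D₀))^[n] 1 x := by rw [Finset.mul_sum]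
    _ ≤ 2 * (1 + r) ^ n := by nlinarith

end Tilted

/-! ### The norm of a centered Markov operator -/

section OperatorNorm

variable {E : Type*} [Fintype E]

/-- Variance decomposition for a probability vector `k` and a complex-valued function. -/
theorem sum_mul_norm_sub_sq {k : E → ℝ} (hk1 : ∑ y, k y = 1) (w : E → ℂ) :
    ∑ y, k y * ‖w y - ∑ z, (k z : ℂ) * w z‖ ^ 2
      = ∑ y, k y * ‖w y‖ ^ 2 - ‖∑ z, (k z : ℂ) * w z‖ ^ 2 := by
  set m := ∑ z, (k z : ℂ) * w z with hm
  have hinner : ∑ y, k y * inner ℝ (w y) m = ‖m‖ ^ 2 := by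
    rw [← real_inner_self_eq_norm_sq]
    conv_rhs => rw [hm, sum_inner]
    refine Finset.sum_congr rfl fun y _ => ?_
    rw [← Complex.real_smul, real_inner_smul_left]
  calc ∑ y, k y * ‖w y - m‖ ^ 2
      = ∑ y, (k y * ‖w y‖ ^ 2 - 2 * (k y * inner ℝ (w y) m) + k y * ‖m‖ ^ 2) :=
        Finset.sum_congr rfl fun y _ => by rw [norm_sub_sq_real]; ring
    _ = ∑ y, k y * ‖w y‖ ^ 2 - 2 * ‖m‖ ^ 2 + ‖m‖ ^ 2 := by
        rw [Finset.sum_add_distrib, Finset.sum_sub_distrib, ← Finset.mul_sum, hinner,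
          ← Finset.sum_mul, hk1, one_mul]
    _ = _ := by ring

theorem l2norm_nonneg (π : E → ℝ) (v : E → ℂ) : 0 ≤ l2norm π v := Real.sqrt_nonneg _

theorem l2norm_sq {π : E → ℝ} (hπ : ∀ x, 0 < π x) (v : E → ℂ) :
    l2norm π v ^ 2 = ∑ x, π x * ‖v x‖ ^ 2 :=
  Real.sq_sqrt (Finset.sum_nonneg fun x _ => mul_nonneg (hπ x).le (sq_nonneg _))

theorem l2norm_mul (π : E → ℝ) (c : ℝ) (v : E → ℂ) :
    l2norm π (fun x => (c : ℂ) * v x) = |c| * l2norm π v := by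
  unfold l2norm
  rw [← Real.sqrt_sq_eq_abs, ← Real.sqrt_mul (sq_nonneg c), Finset.mul_sum]
  congr 1
  refine Finset.sum_congr rfl fun x _ => ?_
  rw [norm_mul, Complex.norm_real, Real.norm_eq_abs, mul_pow, sq_abs]
  ring

theorem centered_mul (π : E → ℝ) (K : E → E → ℝ) (c : ℝ) (v : E → ℂ) (x : E) :
    centered π K (fun x => (c : ℂ) * v x) x = c * centered π K v x := by
  simp only [centered, Finset.mul_sum]
  exact Finset.sum_congr rfl fun y _ => by ring

variable {π : E → ℝ} {K : E → E → ℝ}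

theorem centered_eq (hK1 : ∀ x, ∑ y, K x y = 1) (v : E → ℂ) (x : E) :
    centered π K v x = ∑ y, (K x y : ℂ) * (v y - ∑ z, (π z : ℂ) * v z) := by
  have h : ∑ y, (K x y : ℂ) = 1 := by exact_mod_cast hK1 x
  simp only [centered, mul_sub, sub_mul, Finset.sum_sub_distrib]
  rw [← Finset.sum_mul, h, one_mul]

/-- The exact loss in the contraction inequality: the variance of `v` under one step of the chain plus
the squared mean of `v`. -/
theorem l2norm_centered_sq (hπ : ∀ x, 0 < π x) (hπ1 : ∑ x, π x = 1)
    (hK1 : ∀ x, ∑ y, K x y = 1) (hstat : ∀ y, ∑ x, π x * K x y = π y) (v : E → ℂ) :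
    l2norm π (centered π K v) ^ 2 = l2norm π v ^ 2 - ‖∑ z, (π z : ℂ) * v z‖ ^ 2
      - ∑ x, π x * ∑ y, K x y * ‖(v y - ∑ z, (π z : ℂ) * v z) - centered π K v x‖ ^ 2 := by
  rw [l2norm_sq hπ, l2norm_sq hπ, ← sum_mul_norm_sub_sq hπ1 v]
  set w : E → ℂ := fun y => v y - ∑ z, (π z : ℂ) * v z with hw
  have hc : ∀ x, centered π K v x = ∑ y, (K x y : ℂ) * w y := centered_eq hK1 v
  have hx : ∀ x, ∑ y, K x y * ‖w y - centered π K v x‖ ^ 2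
      = ∑ y, K x y * ‖w y‖ ^ 2 - ‖centered π K v x‖ ^ 2 := by
    intro x
    rw [hc x]
    exact sum_mul_norm_sub_sq (hK1 x) w
  have hs : ∑ x, π x * ∑ y, K x y * ‖w y‖ ^ 2 = ∑ y, π y * ‖w y‖ ^ 2 := by
    simp_rw [Finset.mul_sum]
    rw [Finset.sum_comm]
    refine Finset.sum_congr rfl fun y _ => ?_
    rw [← hstat y, Finset.sum_mul]
    exact Finset.sum_congr rfl fun x _ => by ring
  have : ∑ x, π x * ∑ y, K x y * ‖w y - centered π K v x‖ ^ 2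
      = ∑ y, π y * ‖w y‖ ^ 2 - ∑ x, π x * ‖centered π K v x‖ ^ 2 := by
    simp_rw [hx, mul_sub]
    rw [Finset.sum_sub_distrib, hs]
  simp only [hw] at this ⊢
  rw [this]
  ring

theorem l2norm_centered_le (hπ : ∀ x, 0 < π x) (hπ1 : ∑ x, π x = 1) (hK : ∀ x y, 0 ≤ K x y)
    (hK1 : ∀ x, ∑ y, K x y = 1) (hstat : ∀ y, ∑ x, π x * K x y = π y) (v : E → ℂ) :
    l2norm π (centered π K v) ≤ l2norm π v := by
  refine le_of_sq_le_sq ?_ (l2norm_nonneg _ _)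
  rw [l2norm_centered_sq hπ hπ1 hK1 hstat]
  have : 0 ≤ ∑ x, π x * ∑ y, K x y *
      ‖(v y - ∑ z, (π z : ℂ) * v z) - centered π K v x‖ ^ 2 :=
    Finset.sum_nonneg fun x _ => mul_nonneg (hπ x).le
      (Finset.sum_nonneg fun y _ => mul_nonneg (hK x y) (sq_nonneg _))
  linarith [sq_nonneg ‖∑ z, (π z : ℂ) * v z‖]

theorem opNorm_nonneg : 0 ≤ opNorm π K := by
  refine Real.sSup_nonneg ?_
  rintro r ⟨v, -, rfl⟩
  exact l2norm_nonneg _ _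

theorem l2norm_centered_le_opNorm_mul (hπ : ∀ x, 0 < π x) (hπ1 : ∑ x, π x = 1)
    (hK : ∀ x y, 0 ≤ K x y) (hK1 : ∀ x, ∑ y, K x y = 1)
    (hstat : ∀ y, ∑ x, π x * K x y = π y) (v : E → ℂ) :
    l2norm π (centered π K v) ≤ opNorm π K * l2norm π v := by
  rcases (l2norm_nonneg π v).eq_or_lt with h0 | hpos
  · have := l2norm_centered_le hπ hπ1 hK hK1 hstat v
    rw [← h0] at this ⊢
    linarith
  · set c := (l2norm π v)⁻¹ with hc
    have hc0 : 0 < c := inv_pos.2 hpos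
    have hb : BddAbove {r : ℝ | ∃ v : E → ℂ, l2norm π v = 1 ∧ r = l2norm π (centered π K v)} := by
      refine ⟨1, ?_⟩
      rintro r ⟨v, hv, rfl⟩
      rw [← hv]
      exact l2norm_centered_le hπ hπ1 hK hK1 hstat v
    have h1 := le_csSup hb ⟨fun x => (c : ℂ) * v x, by
      rw [l2norm_mul, abs_of_pos hc0, hc, inv_mul_cancel₀ hpos.ne'], rfl⟩
    have h2 : centered π K (fun x => (c : ℂ) * v x) = fun x => (c : ℂ) * centered π K v x :=
      funext fun x => centered_mul π K c v x
    rw [h2, l2norm_mul, abs_of_pos hc0, hc, inv_mul_le_iff₀ hpos, mul_comm] at h1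
    exact h1

theorem continuous_l2norm (π : E → ℝ) : Continuous (l2norm π) := by
  unfold l2norm
  fun_prop

theorem isCompact_l2norm_sphere (hπ : ∀ x, 0 < π x) :
    IsCompact {v : E → ℂ | l2norm π v = 1} := by
  refine Metric.isCompact_of_isClosed_isBounded
    (isClosed_eq (continuous_l2norm π) continuous_const) ?_
  refine (Bornology.forall_isBounded_image_eval_iff).1 fun x => ?_
  refine isBounded_iff_forall_norm_le.2 ⟨√(1 / π x), ?_⟩
  rintro _ ⟨v, hv, rfl⟩
  have h1 : ∑ x, π x * ‖v x‖ ^ 2 = 1 := by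
    rw [← l2norm_sq hπ, Set.mem_ofPred.1 hv, one_pow]
  refine Real.le_sqrt_of_sq_le ?_
  rw [le_div_iff₀ (hπ x), mul_comm, ← h1]
  exact Finset.single_le_sum (f := fun x => π x * ‖v x‖ ^ 2)
    (fun x _ => mul_nonneg (hπ x).le (sq_nonneg _)) (Finset.mem_univ x)

/-- A chain has a strict spectral gap as soon as every function that is constant on the support of each
row is constant. The norm is attained by compactness, and at a maximizer of norm one the variances of
all rows would vanish. -/
theorem opNorm_lt_one (hπ : ∀ x, 0 < π x) (hπ1 : ∑ x, π x = 1) (hK : ∀ x y, 0 ≤ K x y)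
    (hK1 : ∀ x, ∑ y, K x y = 1) (hstat : ∀ y, ∑ x, π x * K x y = π y)
    (hconn : ∀ w : E → ℂ, (∀ x y y', 0 < K x y → 0 < K x y' → w y = w y') → ∀ x y, w x = w y) :
    opNorm π K < 1 := by
  have hset : {r : ℝ | ∃ v : E → ℂ, l2norm π v = 1 ∧ r = l2norm π (centered π K v)}
      = (fun v => l2norm π (centered π K v)) '' {v : E → ℂ | l2norm π v = 1} := by
    ext r
    simp only [Set.mem_ofPred_eq, Set.mem_image, eq_comm]
  have hcont : Continuous fun v : E → ℂ => l2norm π (centered π K v) := by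
    refine (continuous_l2norm π).comp ?_
    unfold centered
    fun_prop
  have hne : {v : E → ℂ | l2norm π v = 1}.Nonempty := ⟨fun _ => 1, by
    simp [l2norm, hπ1]⟩
  have hmem := ((isCompact_l2norm_sphere hπ).image hcont).sSup_mem (hne.image _)
  obtain ⟨v, hv, hmax⟩ := hmem
  rw [opNorm, hset, ← hmax]
  by_contra hge
  have hge' : 1 ≤ l2norm π (centered π K v) := not_lt.1 hge
  have hsq : 1 ≤ l2norm π (centered π K v) ^ 2 := one_le_pow₀ hge'
  have hvar := l2norm_centered_sq hπ hπ1 hK1 hstat v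
  rw [Set.mem_ofPred.1 hv] at hvar
  set m := ∑ z, (π z : ℂ) * v z with hm
  have hterm : ∀ x y, 0 ≤ K x y * ‖(v y - m) - centered π K v x‖ ^ 2 := fun x y =>
    mul_nonneg (hK x y) (sq_nonneg _)
  have hrow : ∀ x, 0 ≤ π x * ∑ y, K x y * ‖(v y - m) - centered π K v x‖ ^ 2 := fun x =>
    mul_nonneg (hπ x).le (Finset.sum_nonneg fun y _ => hterm x y)
  have hzero : ∑ x, π x * ∑ y, K x y * ‖(v y - m) - centered π K v x‖ ^ 2 = 0 :=
    le_antisymm (by linarith [sq_nonneg ‖m‖]) (Finset.sum_nonneg fun x _ => hrow x)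
  have heq : ∀ x y, 0 < K x y → v y - m = centered π K v x := by
    intro x y hxy
    have h1 := (Finset.sum_eq_zero_iff_of_nonneg fun x _ => hrow x).1 hzero x (Finset.mem_univ x)
    have h2 := (mul_eq_zero.1 h1).resolve_left (hπ x).ne'
    have h3 := (Finset.sum_eq_zero_iff_of_nonneg fun y _ => hterm x y).1 h2 y (Finset.mem_univ y)
    have h4 := (mul_eq_zero.1 h3).resolve_left hxy.ne'
    exact sub_eq_zero.1 (norm_eq_zero.1 (pow_eq_zero_iff two_ne_zero |>.1 h4))
  have hconst := hconn v fun x y y' hy hy' =>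
    sub_left_injective ((heq x y hy).trans (heq x y' hy').symm)
  have hvm : ∀ x, v x = m := by
    intro x
    have h : ∑ z, (π z : ℂ) = 1 := by exact_mod_cast hπ1
    rw [hm]
    simp_rw [fun z => hconst z x]
    rw [← Finset.sum_mul, h, one_mul]
  have hc0 : centered π K v = fun _ => 0 := by
    funext x
    rw [centered_eq hK1]
    refine Finset.sum_eq_zero fun y _ => ?_
    rw [← hm, hvm y, sub_self, mul_zero]
  rw [hc0] at hge'
  norm_num [l2norm] at hge'

end OperatorNorm

/-! ### Path expectations of a finite Markov chain -/

section Paths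

variable {E : Type*} {Ω : Type*} {Z : ℕ → Ω → E}

/-- The event that the path follows `x` at the times `1, …, n`. -/
def cylinder (Z : ℕ → Ω → E) (n : ℕ) (x : ℕ → E) : Set Ω := {ω | ∀ t ∈ Finset.Icc 1 n, Z t ω = x t}

theorem mem_cylinder_succ_update {k : ℕ} (x : ℕ → E) (y : E) (ω : Ω) :
    ω ∈ cylinder Z (k + 1) (Function.update x (k + 1) y)
      ↔ ω ∈ cylinder Z k x ∧ Z (k + 1) ω = y := by
  simp only [cylinder, Set.mem_ofPred_eq, Finset.mem_Icc]
  constructor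
  · intro h
    refine ⟨fun t ht => ?_, ?_⟩
    · have := h t ⟨ht.1, ht.2.trans (Nat.le_succ k)⟩
      rwa [Function.update_of_ne (by omega)] at this
    · simpa using h (k + 1) ⟨by omega, le_rfl⟩
  · rintro ⟨h1, h2⟩ t ht
    rcases eq_or_ne t (k + 1) with rfl | hne
    · simpa using h2
    · rw [Function.update_of_ne hne]
      exact h1 t ⟨ht.1, by omega⟩

variable [MeasurableSpace E] [MeasurableSingletonClass E] [MeasurableSpace Ω]

theorem measurableSet_cylinder (hZ : ∀ t, 1 ≤ t → Measurable (Z t)) (n : ℕ) (x : ℕ → E) :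
    MeasurableSet (cylinder Z n x) := by
  have : cylinder Z n x = ⋂ t ∈ Finset.Icc 1 n, Z t ⁻¹' {x t} := by
    ext ω; simp [cylinder]
  rw [this]
  exact Finset.measurableSet_biInter _ fun t ht =>
    hZ t (Finset.mem_Icc.1 ht).1 (measurableSet_singleton _)

variable [Fintype E] {μ : Measure Ω}

theorem integrable_prod_path [IsFiniteMeasure μ] (hZ : ∀ t, 1 ≤ t → Measurable (Z t)) (e : E → ℝ)
    {I : Finset ℕ} (hI : ∀ t ∈ I, 1 ≤ t) : Integrable (fun ω => ∏ t ∈ I, e (Z t ω)) μ := by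
  have hm : Measurable fun ω (t : I) => Z t.1 ω := measurable_pi_lambda _ fun t => hZ _ (hI _ t.2)
  have h := (Integrable.of_finite (μ := Measure.map (fun ω (t : I) => Z t.1 ω) μ)
    (f := fun x : I → E => ∏ t, e (x t))).comp_measurable hm
  refine h.congr (ae_of_all _ fun ω => ?_)
  exact Finset.prod_coe_sort I fun t => e (Z t ω)

theorem setIntegral_cylinder_succ [IsFiniteMeasure μ] (hZ : ∀ t, 1 ≤ t → Measurable (Z t)) (k : ℕ)
    (x : ℕ → E) {f : Ω → ℝ} (hf : Integrable f μ) :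
    ∫ ω in cylinder Z k x, f ω ∂μ
      = ∑ y, ∫ ω in cylinder Z (k + 1) (Function.update x (k + 1) y), f ω ∂μ := by
  rw [← integral_iUnion_fintype (fun y => measurableSet_cylinder hZ _ _) ?_
    fun y => hf.integrableOn]
  · congr 2
    ext ω
    simp [mem_cylinder_succ_update]
  · intro y y' hne
    refine Set.disjoint_left.2 fun ω h h' => hne ?_
    rw [mem_cylinder_succ_update] at h h'
    exact h.2.symm.trans h'.2

/-- The Markov property, integrated: after following `x` up to time `k`, the expected product of the
factors `e (Z t)` over the next `m` steps is the `m`-fold action of the kernel `K x y * e y`. -/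
theorem IsMarkovChain.setIntegral_cylinder [IsProbabilityMeasure μ] {K : E → E → ℝ}
    (h : IsMarkovChain μ K Z) (e : E → ℝ) (m : ℕ) {k : ℕ} (hk : 1 ≤ k) (x : ℕ → E) :
    ∫ ω in cylinder Z k x, ∏ t ∈ Finset.Ioc k (k + m), e (Z t ω) ∂μ
      = μ.real {ω | Z 1 ω = x 1} * (∏ t ∈ Finset.Ico 1 k, K (x t) (x (t + 1))) *
        (act fun a b => K a b * e b)^[m] 1 (x k) := by
  induction m generalizing k x with
  | zero =>
    simp only [add_zero, Finset.Ioc_self, Finset.prod_empty, Function.iterate_zero, id_eq,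
      Pi.one_apply, mul_one, integral_const, MeasurableSet.univ, measureReal_restrict_apply,
      Set.univ_inter, smul_eq_mul]
    exact h.2 k x hk
  | succ m ih =>
    have hint : Integrable (fun ω => ∏ t ∈ Finset.Ioc k (k + (m + 1)), e (Z t ω)) μ :=
      integrable_prod_path h.1 e fun t ht => by
        have := (Finset.mem_Ioc.1 ht).1
        omega
    rw [setIntegral_cylinder_succ h.1 k x hint, Function.iterate_succ_apply', act, Finset.mul_sum]
    refine Finset.sum_congr rfl fun y _ => ?_
    have hIoc : Finset.Ioc k (k + (m + 1)) = insert (k + 1) (Finset.Ioc (k + 1) (k + 1 + m)) := by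
      ext t
      simp only [Finset.mem_Ioc, Finset.mem_insert]
      omega
    have hcongr : ∫ ω in cylinder Z (k + 1) (Function.update x (k + 1) y),
          ∏ t ∈ Finset.Ioc k (k + (m + 1)), e (Z t ω) ∂μ
        = ∫ ω in cylinder Z (k + 1) (Function.update x (k + 1) y),
          e y * ∏ t ∈ Finset.Ioc (k + 1) (k + 1 + m), e (Z t ω) ∂μ := by
      refine setIntegral_congr_fun (measurableSet_cylinder h.1 _ _) fun ω hω => ?_
      rw [hIoc, Finset.prod_insert (by simp), ((mem_cylinder_succ_update x y ω).1 hω).2]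
    rw [hcongr, integral_const_mul, ih (by omega), Finset.prod_Ico_succ_top hk,
      Function.update_self, Function.update_of_ne (by omega),
      Function.update_of_ne (by omega : k ≠ k + 1)]
    have hprod : ∏ t ∈ Finset.Ico 1 k, K (Function.update x (k + 1) y t)
          (Function.update x (k + 1) y (t + 1)) = ∏ t ∈ Finset.Ico 1 k, K (x t) (x (t + 1)) := by
      refine Finset.prod_congr rfl fun t ht => ?_
      have := (Finset.mem_Ico.1 ht).2
      rw [Function.update_of_ne (by omega), Function.update_of_ne (by omega)]
    rw [hprod]
    ring

theorem IsMarkovChain.integral_prod [IsProbabilityMeasure μ] {K : E → E → ℝ}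
    (h : IsMarkovChain μ K Z) (e : E → ℝ) (n : ℕ) :
    ∫ ω, ∏ t ∈ Finset.Icc 1 (n + 1), e (Z t ω) ∂μ
      = ∑ y, μ.real {ω | Z 1 ω = y} * (e y * (act fun a b => K a b * e b)^[n] 1 y) := by
  have hempty : ∀ x : ℕ → E, cylinder Z 0 x = Set.univ := fun x => by
    ext ω; simp [cylinder]
  have hint : Integrable (fun ω => ∏ t ∈ Finset.Icc 1 (n + 1), e (Z t ω)) μ :=
    integrable_prod_path h.1 e fun t ht => (Finset.mem_Icc.1 ht).1
  have hne : Nonempty E := by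
    have : Nonempty Ω := μ.nonempty_of_neZero
    exact this.map (Z 1)
  obtain ⟨x₀⟩ := hne
  rw [← setIntegral_univ, ← hempty fun _ => x₀,
    setIntegral_cylinder_succ h.1 0 (fun _ => x₀) hint]
  refine Finset.sum_congr rfl fun y _ => ?_
  have hcongr : ∫ ω in cylinder Z (0 + 1) (Function.update (fun _ => x₀) (0 + 1) y),
        ∏ t ∈ Finset.Icc 1 (n + 1), e (Z t ω) ∂μ
      = ∫ ω in cylinder Z (0 + 1) (Function.update (fun _ => x₀) (0 + 1) y),
        e y * ∏ t ∈ Finset.Ioc 1 (1 + n), e (Z t ω) ∂μ := by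
    refine setIntegral_congr_fun (measurableSet_cylinder h.1 _ _) fun ω hω => ?_
    have hIcc : Finset.Icc 1 (n + 1) = insert 1 (Finset.Ioc 1 (1 + n)) := by
      ext t
      simp only [Finset.mem_Icc, Finset.mem_Ioc, Finset.mem_insert]
      omega
    have hy := ((mem_cylinder_succ_update _ y ω).1 hω).2
    rw [zero_add] at hy
    rw [hIcc, Finset.prod_insert (by simp), hy]
  rw [hcongr, integral_const_mul, h.setIntegral_cylinder e n le_rfl]
  simp only [zero_add, Function.update_self, Finset.Ico_self, Finset.prod_empty, mul_one]
  ring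

end Paths

/-! ### Stationarity and spectral gap of the sampler -/

section Weights

variable {P : ℕ} {p : Incl P → ℝ} {η : (j : Fin P) → ({k : Fin P // k ≠ j} → Bool) → ℝ}

theorem flipAt_flipAt (γ : Incl P) (j : Fin P) : flipAt (flipAt γ j) j = γ := by
  simp [flipAt]

theorem eq_flipAt_comm {γ γ' : Incl P} {j : Fin P} : γ' = flipAt γ j ↔ γ = flipAt γ' j := by
  constructor <;> rintro rfl <;> rw [flipAt_flipAt]

theorem update_flipAt (γ : Incl P) (j : Fin P) (b : Bool) :
    Function.update (flipAt γ j) j b = Function.update γ j b := by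
  simp [flipAt]

/-- The values `p` takes on the two settings of the coordinate `j` are those at `γ` and at its flip. -/
theorem update_true_add_update_false (f : Incl P → ℝ) (γ : Incl P) (j : Fin P) :
    f (Function.update γ j true) + f (Function.update γ j false) = f γ + f (flipAt γ j) := by
  unfold flipAt
  cases h : γ j
  · rw [add_comm, show Function.update γ j false = γ by rw [← h, Function.update_eq_self]]
    rfl
  · rw [show Function.update γ j true = γ by rw [← h, Function.update_eq_self]]
    rfl

theorem condProb_flipAt (j : Fin P) (b : Bool) (γ : Incl P) :
    condProb p j b (flipAt γ j) = condProb p j b γ := by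
  simp only [condProb, update_flipAt]

theorem condProb_pos (hp : ∀ γ, 0 < p γ) (j : Fin P) (b : Bool) (γ : Incl P) :
    0 < condProb p j b γ :=
  div_pos (hp _) (add_pos (hp _) (hp _))

theorem condProb_le_one (hp : ∀ γ, 0 < p γ) (j : Fin P) (b : Bool) (γ : Incl P) :
    condProb p j b γ ≤ 1 := by
  rw [condProb, div_le_one (add_pos (hp _) (hp _))]
  cases b
  · linarith [hp (Function.update γ j true)]
  · linarith [hp (Function.update γ j false)]

theorem weight_pos (hp : ∀ γ, 0 < p γ) (hη : ∀ j g, 0 < η j g) (j : Fin P) (γ : Incl P) :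
    0 < weight p η j γ :=
  div_pos (mul_pos (by norm_num) (hη _ _)) (condProb_pos hp _ _ _)

theorem mul_weight (hp : ∀ γ, 0 < p γ) (j : Fin P) (γ : Incl P) :
    p γ * weight p η j γ = 1 / 2 * η j (fun k => γ k.1) * (p γ + p (flipAt γ j)) := by
  have h1 := (hp γ).ne'
  have h2 := (add_pos (hp γ) (hp (flipAt γ j))).ne'
  rw [weight, condProb, Function.update_eq_self, update_true_add_update_false]
  field_simp

theorem mul_weight_flipAt (hp : ∀ γ, 0 < p γ) (j : Fin P) (γ : Incl P) :
    p (flipAt γ j) * weight p η j (flipAt γ j) = p γ * weight p η j γ := by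
  have hrest : (fun k : {k : Fin P // k ≠ j} => flipAt γ j k.1) = fun k => γ k.1 :=
    funext fun k => Function.update_of_ne k.2 _ _
  rw [mul_weight hp, mul_weight hp, hrest, flipAt_flipAt, add_comm (p (flipAt γ j))]

theorem PIP_pos (hp : ∀ γ, 0 < p γ) (i : Fin P) : 0 < PIP p i := by
  refine Finset.sum_pos' (fun γ _ => ?_) ⟨fun _ => true, Finset.mem_univ _, ?_⟩
  · split_ifs
    exacts [(hp γ).le, le_rfl]
  · simpa using hp _

theorem PIP_le_one (hp : ∀ γ, 0 < p γ) (hp1 : ∑ γ, p γ = 1) (i : Fin P) : PIP p i ≤ 1 := by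
  rw [← hp1]
  refine Finset.sum_le_sum fun γ _ => ?_
  split_ifs
  exacts [le_rfl, (hp γ).le]

theorem sum_flipAt (f : Incl P → ℝ) (j : Fin P) : ∑ γ, f (flipAt γ j) = ∑ γ, f γ :=
  Equiv.sum_comp (Function.Involutive.toPerm (fun γ => flipAt γ j) fun γ => flipAt_flipAt γ j) f

/-- The Rao-Blackwellized inclusion indicator has mean `PIP(i)`. -/
theorem sum_mul_condProb (hp : ∀ γ, 0 < p γ) (i : Fin P) :
    ∑ γ, p γ * condProb p i true γ = PIP p i := by
  have h1 : ∑ γ, p γ * condProb p i true γ + ∑ γ, p (flipAt γ i) * condProb p i true γ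
      = ∑ γ, p (Function.update γ i true) := by
    rw [← Finset.sum_add_distrib]
    refine Finset.sum_congr rfl fun γ _ => ?_
    have := (add_pos (hp γ) (hp (flipAt γ i))).ne'
    rw [condProb, update_true_add_update_false]
    field_simp
  have h2 : ∑ γ, p (flipAt γ i) * condProb p i true γ = ∑ γ, p γ * condProb p i true γ := by
    rw [← sum_flipAt (fun γ => p γ * condProb p i true γ) i]
    simp only [condProb_flipAt]
  have h3 : ∑ γ, p (Function.update γ i true) = PIP p i + PIP p i := by
    unfold PIP
    conv_rhs => arg 2; rw [← sum_flipAt _ i]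
    rw [← Finset.sum_add_distrib]
    refine Finset.sum_congr rfl fun γ _ => ?_
    cases h : γ i
    · simp [flipAt, h]
    · have : Function.update γ i true = γ := by rw [← h, Function.update_eq_self]
      simp [flipAt, h, this]
  linarith

theorem iInf_piMarg_le (γ : Incl P) : ⨅ γ, piMarg p η γ ≤ piMarg p η γ :=
  ciInf_le (Set.finite_range _).bddBelow γ

/-- A function on the hypercube that is invariant under every flip is constant. -/
theorem eq_of_flipAt_invariant {α : Type*} {f : Incl P → α} (hf : ∀ γ j, f (flipAt γ j) = f γ)
    (γ γ' : Incl P) : f γ = f γ' := by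
  have key : ∀ s : Finset (Fin P), f (fun k => if k ∈ s then γ' k else γ k) = f γ := by
    intro s
    induction s using Finset.induction_on with
    | empty => simp
    | insert j s hj ih =>
      rw [← ih]
      set β : Incl P := fun k => if k ∈ s then γ' k else γ k with hβ
      have hup : (fun k => if k ∈ insert j s then γ' k else γ k) = Function.update β j (γ' j) := by
        funext k
        by_cases hk : k = j
        · subst hk; simp
        · simp [hβ, hk]
      rw [hup]
      by_cases h : γ' j = β j
      · rw [h, Function.update_eq_self]
      · have : γ' j = !β j := by
          cases h1 : γ' j <;> cases h2 : β j <;> simp_all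
        rw [this]
        exact hf β j
  simpa using (key Finset.univ).symm

variable [Nonempty (Fin P)]

theorem phi_pos (hp : ∀ γ, 0 < p γ) (hη : ∀ j g, 0 < η j g) (γ : Incl P) : 0 < phi p η γ :=
  Finset.sum_pos (fun j _ => weight_pos hp hη j γ) Finset.univ_nonempty

theorem chooseProb_pos (hp : ∀ γ, 0 < p γ) (hη : ∀ j g, 0 < η j g) (j : Fin P) (γ : Incl P) :
    0 < chooseProb p η j γ :=
  mul_pos (inv_pos.2 (phi_pos hp hη γ)) (weight_pos hp hη j γ)

theorem sum_chooseProb (hp : ∀ γ, 0 < p γ) (hη : ∀ j g, 0 < η j g) (γ : Incl P) :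
    ∑ j, chooseProb p η j γ = 1 := by
  simp only [chooseProb]
  rw [← Finset.mul_sum]
  exact inv_mul_cancel₀ (phi_pos hp hη γ).ne'

theorem target_pos (hp : ∀ γ, 0 < p γ) (hη : ∀ j g, 0 < η j g) (γ : Incl P) :
    0 < target p η γ :=
  mul_pos (phi_pos hp hη γ) (hp γ)

theorem sum_target_pos (hp : ∀ γ, 0 < p γ) (hη : ∀ j g, 0 < η j g) : 0 < ∑ γ, target p η γ :=
  Finset.sum_pos (fun γ _ => target_pos hp hη γ) Finset.univ_nonempty

theorem piMarg_pos (hp : ∀ γ, 0 < p γ) (hη : ∀ j g, 0 < η j g) (γ : Incl P) :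
    0 < piMarg p η γ :=
  div_pos (target_pos hp hη γ) (sum_target_pos hp hη)

theorem sum_piMarg (hp : ∀ γ, 0 < p γ) (hη : ∀ j g, 0 < η j g) : ∑ γ, piMarg p η γ = 1 := by
  simp only [piMarg]
  rw [← Finset.sum_div, div_self (sum_target_pos hp hη).ne']

theorem iInf_piMarg_pos (hp : ∀ γ, 0 < p γ) (hη : ∀ j g, 0 < η j g) :
    0 < ⨅ γ, piMarg p η γ := by
  obtain ⟨γ, hγ⟩ := exists_eq_ciInf_of_finite (f := piMarg p η)
  rw [← hγ]
  exact piMarg_pos hp hη γ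

variable (p η) in
/-- The kernel that flips a coordinate drawn from `f(· | γ)`. -/
def flipKernel (γ γ' : Incl P) : ℝ :=
  ∑ j, chooseProb p η j γ * (if γ' = flipAt γ j then 1 else 0)

theorem flipKernel_nonneg (hp : ∀ γ, 0 < p γ) (hη : ∀ j g, 0 < η j g) (γ γ' : Incl P) :
    0 ≤ flipKernel p η γ γ' :=
  Finset.sum_nonneg fun j _ => mul_nonneg (chooseProb_pos hp hη j γ).le (by split_ifs <;> simp)

theorem flipKernel_flipAt_pos (hp : ∀ γ, 0 < p γ) (hη : ∀ j g, 0 < η j g) (γ : Incl P)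
    (j : Fin P) : 0 < flipKernel p η γ (flipAt γ j) := by
  refine Finset.sum_pos' (fun j _ => mul_nonneg (chooseProb_pos hp hη j γ).le
    (by split_ifs <;> simp)) ⟨j, Finset.mem_univ _, ?_⟩
  simpa using chooseProb_pos hp hη j γ

theorem sum_flipKernel (hp : ∀ γ, 0 < p γ) (hη : ∀ j g, 0 < η j g) (γ : Incl P) :
    ∑ γ', flipKernel p η γ γ' = 1 := by
  unfold flipKernel
  rw [Finset.sum_comm]
  refine (Finset.sum_congr rfl fun j _ => ?_).trans (sum_chooseProb hp hη γ)
  rw [← Finset.mul_sum, Finset.sum_ite_eq', if_pos (Finset.mem_univ _), mul_one]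

/-- Detailed balance: `π(γ) f(j | γ)` is proportional to `p(γ) w_j(γ)`, which does not depend on the
coordinate `j` of `γ`. -/
theorem piMarg_mul_flipKernel (hp : ∀ γ, 0 < p γ) (hη : ∀ j g, 0 < η j g) (γ γ' : Incl P) :
    piMarg p η γ * flipKernel p η γ γ' = piMarg p η γ' * flipKernel p η γ' γ := by
  have hbal : ∀ (j : Fin P) (γ : Incl P), piMarg p η γ * chooseProb p η j γ
      = p γ * weight p η j γ / ∑ γ', target p η γ' := by
    intro j γ
    have h1 := (phi_pos hp hη γ).ne'
    have h2 := (sum_target_pos hp hη).ne'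
    simp only [piMarg, chooseProb, target] at h2 ⊢
    field_simp
  simp only [flipKernel, Finset.mul_sum]
  refine Finset.sum_congr rfl fun j _ => ?_
  rw [← mul_assoc, ← mul_assoc, hbal, hbal]
  by_cases h : γ' = flipAt γ j
  · rw [if_pos h, if_pos (eq_flipAt_comm.1 h), h, mul_weight_flipAt hp]
  · rw [if_neg h, if_neg fun h' => h (eq_flipAt_comm.1 h'), mul_zero, mul_zero]

theorem sum_piMarg_mul_flipKernel (hp : ∀ γ, 0 < p γ) (hη : ∀ j g, 0 < η j g) (γ' : Incl P) :
    ∑ γ, piMarg p η γ * flipKernel p η γ γ' = piMarg p η γ' := by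
  simp_rw [fun γ => piMarg_mul_flipKernel hp hη γ γ']
  rw [← Finset.mul_sum, sum_flipKernel hp hη, mul_one]

theorem sum_piMarg_mul_act_flipKernel (hp : ∀ γ, 0 < p γ) (hη : ∀ j g, 0 < η j g)
    (u : Incl P → ℝ) :
    ∑ γ, piMarg p η γ * act (flipKernel p η) u γ = ∑ γ, piMarg p η γ * u γ := by
  simp only [act, Finset.mul_sum]
  rw [Finset.sum_comm]
  refine Finset.sum_congr rfl fun γ' _ => ?_
  rw [← sum_piMarg_mul_flipKernel hp hη γ', Finset.sum_mul]
  exact Finset.sum_congr rfl fun γ _ => by ring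

end Weights

section Gap

variable {P : ℕ} {p : Incl P → ℝ} {η : (j : Fin P) → ({k : Fin P // k ≠ j} → Bool) → ℝ} {S : ℝ}

theorem bern_pos (hS : 0 < S) (hSP : S < P) (b : Bool) : 0 < bern P S b := by
  have hP : (0 : ℝ) < P := hS.trans hSP
  unfold bern
  split_ifs
  · positivity
  · rw [sub_pos, div_lt_one hP]
    exact hSP

theorem sum_bern : ∑ b, bern P S b = 1 := by
  simp [bern]

theorem kernelStar_eq (γ γ' : Incl P) :
    kernelStar p η S γ γ' = tilted (S / P) (flipKernel p η) 1 1 γ γ' := by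
  simp [kernelStar, tilted, flipKernel]

theorem act_kernelStar (u : Incl P → ℝ) (γ : Incl P) :
    act (kernelStar p η S) u γ = S / P * act (flipKernel p η) u γ + (1 - S / P) * u γ := by
  have : kernelStar p η S = tilted (S / P) (flipKernel p η) 1 1 :=
    funext fun γ => funext fun γ' => kernelStar_eq γ γ'
  rw [this, act_tilted]
  simp

/-- Expectations under `π(γ, Q) = π(γ) q(Q)`. -/
theorem sum_piJoint_mul (f : State P → ℝ) :
    ∑ x, piJoint p η S x * f x
      = ∑ γ, piMarg p η γ * (S / P * f (γ, true) + (1 - S / P) * f (γ, false)) := by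
  rw [Fintype.sum_prod_type]
  refine Finset.sum_congr rfl fun γ _ => ?_
  simp only [Fintype.sum_bool, piJoint, bern, if_true, Bool.false_eq_true, if_false]
  ring

theorem lamGQ_nonneg : 0 ≤ lamGQ p η S := opNorm_nonneg

variable [Nonempty (Fin P)]

theorem piJoint_pos (hp : ∀ γ, 0 < p γ) (hη : ∀ j g, 0 < η j g) (hS : 0 < S) (hSP : S < P)
    (x : State P) : 0 < piJoint p η S x :=
  mul_pos (piMarg_pos hp hη _) (bern_pos hS hSP _)

theorem sum_piJoint (hp : ∀ γ, 0 < p γ) (hη : ∀ j g, 0 < η j g) :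
    ∑ x, piJoint p η S x = 1 := by
  have h := sum_piJoint_mul (p := p) (η := η) (S := S) fun _ => 1
  simp only [mul_one] at h
  rw [h]
  simp only [add_sub_cancel, mul_one]
  exact sum_piMarg hp hη

theorem sum_kernelStar (hp : ∀ γ, 0 < p γ) (hη : ∀ j g, 0 < η j g) (γ : Incl P) :
    ∑ γ', kernelStar p η S γ γ' = 1 := by
  have h := act_kernelStar (p := p) (η := η) (S := S) 1 γ
  simp only [act, Pi.one_apply, mul_one] at h
  rw [h, sum_flipKernel hp hη]
  ring

theorem sum_piMarg_mul_kernelStar (hp : ∀ γ, 0 < p γ) (hη : ∀ j g, 0 < η j g) (γ' : Incl P) :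
    ∑ γ, piMarg p η γ * kernelStar p η S γ γ' = piMarg p η γ' := by
  have h : ∀ γ, piMarg p η γ * kernelStar p η S γ γ'
      = S / P * (piMarg p η γ * flipKernel p η γ γ')
        + (1 - S / P) * (if γ' = γ then piMarg p η γ else 0) := by
    intro γ
    rw [kernelStar_eq, tilted]
    simp only [Pi.one_apply, mul_one]
    split_ifs <;> ring
  simp_rw [h]
  rw [Finset.sum_add_distrib, ← Finset.mul_sum, ← Finset.mul_sum,
    sum_piMarg_mul_flipKernel hp hη, Finset.sum_ite_eq, if_pos (Finset.mem_univ _)]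
  ring

theorem kernelStar_nonneg (hp : ∀ γ, 0 < p γ) (hη : ∀ j g, 0 < η j g) (hS : 0 < S) (hSP : S < P)
    (γ γ' : Incl P) : 0 ≤ kernelStar p η S γ γ' := by
  have h1 := (bern_pos hS hSP true).le
  have h2 := (bern_pos hS hSP false).le
  simp only [bern, if_true, Bool.false_eq_true, if_false] at h1 h2
  exact add_nonneg (mul_nonneg h1 (flipKernel_nonneg hp hη _ _))
    (mul_nonneg h2 (by split_ifs <;> simp))

theorem kernelRev_nonneg (hp : ∀ γ, 0 < p γ) (hη : ∀ j g, 0 < η j g) (hS : 0 < S) (hSP : S < P)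
    (x y : State P) : 0 ≤ kernelRev p η S x y :=
  mul_nonneg (kernelStar_nonneg hp hη hS hSP _ _) (bern_pos hS hSP _).le

theorem sum_kernelRev (hp : ∀ γ, 0 < p γ) (hη : ∀ j g, 0 < η j g) (x : State P) :
    ∑ y, kernelRev p η S x y = 1 := by
  simp only [kernelRev]
  rw [Fintype.sum_prod_type]
  simp only [← Finset.mul_sum, sum_bern, mul_one]
  exact sum_kernelStar hp hη x.1

theorem sum_piJoint_mul_kernelRev (hp : ∀ γ, 0 < p γ) (hη : ∀ j g, 0 < η j g) (y : State P) :
    ∑ x, piJoint p η S x * kernelRev p η S x y = piJoint p η S y := by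
  rw [sum_piJoint_mul, piJoint, ← sum_piMarg_mul_kernelStar (S := S) hp hη y.1, Finset.sum_mul]
  refine Finset.sum_congr rfl fun γ _ => ?_
  simp only [kernelRev]
  ring

theorem lamGQ_lt_one (hp : ∀ γ, 0 < p γ) (hη : ∀ j g, 0 < η j g) (hS : 0 < S) (hSP : S < P) :
    lamGQ p η S < 1 := by
  refine opNorm_lt_one (piJoint_pos hp hη hS hSP) (sum_piJoint hp hη)
    (kernelRev_nonneg hp hη hS hSP) (sum_kernelRev hp hη) (sum_piJoint_mul_kernelRev hp hη) ?_
  intro w hw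
  have hs := bern_pos hS hSP true
  have hs' := bern_pos hS hSP false
  simp only [bern, if_true, Bool.false_eq_true, if_false] at hs hs'
  have hstay : ∀ γ Q Q', 0 < kernelRev p η S (γ, Q) (γ, Q') := by
    intro γ Q Q'
    refine mul_pos (add_pos_of_nonneg_of_pos
      (mul_nonneg hs.le (flipKernel_nonneg hp hη _ _)) ?_) (bern_pos hS hSP _)
    simpa using hs'
  have hflip : ∀ γ Q Q' j, 0 < kernelRev p η S (γ, Q) (flipAt γ j, Q') := by
    intro γ Q Q' j
    refine mul_pos (add_pos_of_pos_of_nonneg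
      (mul_pos hs (flipKernel_flipAt_pos hp hη _ _)) ?_) (bern_pos hS hSP _)
    exact mul_nonneg hs'.le (by split_ifs <;> simp)
  have hQ : ∀ γ Q Q', w (γ, Q) = w (γ, Q') := fun γ Q Q' =>
    hw (γ, Q) _ _ (hstay γ Q Q) (hstay γ Q Q')
  have hconst := eq_of_flipAt_invariant (f := fun γ => w (γ, true)) fun γ j =>
    hw (γ, true) _ _ (hflip γ true true j) (hstay γ true true)
  rintro ⟨γ, Q⟩ ⟨γ', Q'⟩
  rw [hQ γ Q true, hQ γ' Q' true]
  exact hconst γ γ'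

/-- On functions of `γ` alone `K` acts as `K*`, so `λ` bounds `K*` on mean-zero functions. -/
theorem sum_piMarg_mul_act_kernelStar_sq_le (hp : ∀ γ, 0 < p γ) (hη : ∀ j g, 0 < η j g)
    (hS : 0 < S) (hSP : S < P) {u : Incl P → ℝ} (hu : ∑ γ, piMarg p η γ * u γ = 0) :
    ∑ γ, piMarg p η γ * act (kernelStar p η S) u γ ^ 2
      ≤ lamGQ p η S ^ 2 * ∑ γ, piMarg p η γ * u γ ^ 2 := by
  set v : State P → ℂ := fun x => (u x.1 : ℂ) with hv
  have hπ := piJoint_pos hp hη hS hSP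
  have hlift : ∀ f : Incl P → ℝ, ∑ x, piJoint p η S x * f x.1 = ∑ γ, piMarg p η γ * f γ := by
    intro f
    rw [sum_piJoint_mul fun x => f x.1]
    exact Finset.sum_congr rfl fun γ _ => by ring
  have hc : ∀ x, centered (piJoint p η S) (kernelRev p η S) v x
      = ((act (kernelStar p η S) u x.1 : ℝ) : ℂ) := by
    intro x
    have h1 : ∑ y, kernelRev p η S x y * u y.1 = act (kernelStar p η S) u x.1 := by
      simp only [kernelRev]
      rw [Fintype.sum_prod_type]
      refine Finset.sum_congr rfl fun γ _ => ?_
      simp only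
      rw [← Finset.sum_mul, ← Finset.mul_sum, sum_bern, mul_one]
    have h2 : ∑ y, (kernelRev p η S x y - piJoint p η S y) * u y.1
        = act (kernelStar p η S) u x.1 := by
      simp_rw [sub_mul]
      rw [Finset.sum_sub_distrib, h1, hlift, hu, sub_zero]
    rw [← h2, centered]
    push_cast
    rfl
  have h := l2norm_centered_le_opNorm_mul hπ (sum_piJoint hp hη) (kernelRev_nonneg hp hη hS hSP)
    (sum_kernelRev hp hη) (sum_piJoint_mul_kernelRev hp hη) v
  have h2 := pow_le_pow_left₀ (l2norm_nonneg _ _) h 2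
  rw [mul_pow, l2norm_sq hπ, l2norm_sq hπ] at h2
  simp only [hc] at h2
  simp only [hv, Complex.norm_real, Real.norm_eq_abs, sq_abs] at h2
  rw [hlift fun γ => act (kernelStar p η S) u γ ^ 2, hlift fun γ => u γ ^ 2] at h2
  exact h2

/-- The spectral gap in the form of a bound on the quadratic form of the flip kernel, valid for all
functions. -/
theorem flipKernel_gap (hp : ∀ γ, 0 < p γ) (hη : ∀ j g, 0 < η j g) (hS : 0 < S) (hSP : S < P)
    (u : Incl P → ℝ) :
    S / P * ∑ γ, piMarg p η γ * (u γ * act (flipKernel p η) u γ)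
      ≤ (1 - lamGQ p η S) * (∑ γ, piMarg p η γ * u γ) ^ 2
        + (S / P - (1 - lamGQ p η S)) * ∑ γ, piMarg p η γ * u γ ^ 2 := by
  have hπ := piMarg_pos hp hη
  have hπ1 := sum_piMarg hp hη
  set m := ∑ γ, piMarg p η γ * u γ with hm
  set w : Incl P → ℝ := fun γ => u γ - m with hw
  have hw0 : ∑ γ, piMarg p η γ * w γ = 0 := by
    simp only [hw, mul_sub]
    rw [Finset.sum_sub_distrib, ← Finset.sum_mul, hπ1, one_mul, ← hm, sub_self]
  have hsq : ∑ γ, piMarg p η γ * w γ ^ 2 = ∑ γ, piMarg p η γ * u γ ^ 2 - m ^ 2 := by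
    have : ∀ γ, piMarg p η γ * w γ ^ 2 = piMarg p η γ * u γ ^ 2 - 2 * m * (piMarg p η γ * u γ)
        + m ^ 2 * piMarg p η γ := fun γ => by simp only [hw]; ring
    simp_rw [this]
    rw [Finset.sum_add_distrib, Finset.sum_sub_distrib, ← Finset.mul_sum, ← Finset.mul_sum, hπ1,
      ← hm]
    ring
  have hactw : ∀ γ, act (flipKernel p η) u γ = act (flipKernel p η) w γ + m := by
    intro γ
    have h1 : act (flipKernel p η) (fun _ => m) γ = m := by
      simp only [act]
      rw [← Finset.sum_mul, sum_flipKernel hp hη, one_mul]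
    have h2 := act_add (flipKernel p η) w (fun _ => m) γ
    rw [h1] at h2
    rw [← h2]
    simp [hw]
  have hquad : ∑ γ, piMarg p η γ * (u γ * act (flipKernel p η) u γ)
      = ∑ γ, piMarg p η γ * (w γ * act (flipKernel p η) w γ) + m ^ 2 := by
    have : ∀ γ, piMarg p η γ * (u γ * act (flipKernel p η) u γ)
        = piMarg p η γ * (w γ * act (flipKernel p η) w γ) + m * (piMarg p η γ * w γ)
          + m * (piMarg p η γ * act (flipKernel p η) w γ) + m ^ 2 * piMarg p η γ := fun γ => by
      rw [hactw]; simp only [hw]; ring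
    simp_rw [this]
    rw [Finset.sum_add_distrib, Finset.sum_add_distrib, Finset.sum_add_distrib, ← Finset.mul_sum,
      ← Finset.mul_sum, ← Finset.mul_sum, sum_piMarg_mul_act_flipKernel hp hη, hw0, hπ1]
    ring
  set V := ∑ γ, piMarg p η γ * w γ ^ 2 with hV
  have hV0 : 0 ≤ V := Finset.sum_nonneg fun γ _ => mul_nonneg (hπ γ).le (sq_nonneg _)
  have hcs : ∑ γ, piMarg p η γ * (w γ * act (kernelStar p η S) w γ) ≤ lamGQ p η S * V := by
    refine le_of_sq_le_sq ?_ (mul_nonneg lamGQ_nonneg hV0)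
    calc (∑ γ, piMarg p η γ * (w γ * act (kernelStar p η S) w γ)) ^ 2
        ≤ V * ∑ γ, piMarg p η γ * act (kernelStar p η S) w γ ^ 2 :=
          Finset.sum_sq_le_sum_mul_sum_of_sq_le_mul _
            (fun γ _ => mul_nonneg (hπ γ).le (sq_nonneg _))
            (fun γ _ => mul_nonneg (hπ γ).le (sq_nonneg _)) fun γ _ => le_of_eq (by ring)
      _ ≤ V * (lamGQ p η S ^ 2 * V) :=
          mul_le_mul_of_nonneg_left (sum_piMarg_mul_act_kernelStar_sq_le hp hη hS hSP hw0) hV0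
      _ = _ := by ring
  have hstar : ∑ γ, piMarg p η γ * (w γ * act (kernelStar p η S) w γ)
      = S / P * ∑ γ, piMarg p η γ * (w γ * act (flipKernel p η) w γ) + (1 - S / P) * V := by
    rw [hV, Finset.mul_sum, Finset.mul_sum, ← Finset.sum_add_distrib]
    refine Finset.sum_congr rfl fun γ _ => ?_
    rw [act_kernelStar]
    ring
  rw [hquad]
  have hU : ∑ γ, piMarg p η γ * u γ ^ 2 = V + m ^ 2 := by rw [hsq]; ring
  rw [hU]
  linarith

end Gap

/-! ### A Chernoff bound for the sampler -/

section Chernoff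

variable {P : ℕ} {p : Incl P → ℝ} {η : (j : Fin P) → ({k : Fin P // k ≠ j} → Bool) → ℝ} {S : ℝ}

/-- On functions of `γ` the kernel `K x y * e y` is tilted by the average of `e` over `Q`, since `Q` is
drawn independently of the move. -/
theorem act_kernelRev_lift (e : State P → ℝ) (v : Incl P → ℝ) (x : State P) :
    act (fun a b => kernelRev p η S a b * e b) (fun y => v y.1) x
      = act (tilted (S / P) (flipKernel p η)
          (fun γ => S / P * e (γ, true) + (1 - S / P) * e (γ, false))
          (fun γ => S / P * e (γ, true) + (1 - S / P) * e (γ, false))) v x.1 := by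
  simp only [act]
  rw [Fintype.sum_prod_type]
  refine Finset.sum_congr rfl fun γ _ => ?_
  simp only [Fintype.sum_bool, kernelRev, kernelStar_eq, tilted, bern, if_true,
    Bool.false_eq_true, if_false, Pi.one_apply]
  split_ifs <;> ring

/-- For the sampler read literally, `Q` tells whether a coordinate was flipped, so the two parts of the
kernel carry different factors. -/
theorem act_kernelAlg_lift (e : State P → ℝ) (v : Incl P → ℝ) (x : State P) :
    act (fun a b => kernelAlg p η S a b * e b) (fun y => v y.1) x
      = act (tilted (S / P) (flipKernel p η) (fun γ => e (γ, true)) (fun γ => e (γ, false)))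
          v x.1 := by
  simp only [act]
  rw [Fintype.sum_prod_type]
  refine Finset.sum_congr rfl fun γ _ => ?_
  simp only [Fintype.sum_bool, kernelAlg, tilted, flipKernel, if_true, Bool.false_eq_true, if_false]
  split_ifs <;> ring

theorem abs_convexCombination_le {s a b c : ℝ} (hs0 : 0 ≤ s) (hs1 : s ≤ 1) (ha : |a - 1| ≤ c)
    (hb : |b - 1| ≤ c) : |s * a + (1 - s) * b - 1| ≤ c := by
  obtain ⟨h1, h2⟩ := abs_le.1 ha
  obtain ⟨h3, h4⟩ := abs_le.1 hb
  rw [abs_le]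
  constructor <;> nlinarith

variable [Nonempty (Fin P)] {Ω : Type*} [MeasurableSpace Ω] {μ : Measure Ω}
  [IsProbabilityMeasure μ] {Z : ℕ → Ω → State P}

/-- An initial law supported on `Q = 1` has density at most `P / (S min π)` with respect to the
stationary distribution. -/
theorem measureReal_initial_le (hp : ∀ γ, 0 < p γ) (hη : ∀ j g, 0 < η j g) (hS : 0 < S) (hSP : S < P)
    (hZ1 : ∀ᵐ ω ∂μ, (Z 1 ω).2 = true) (y : State P) :
    μ.real {ω | Z 1 ω = y} ≤ P / (S * ⨅ γ, piMarg p η γ) * piJoint p η S y := by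
  have hP : (0 : ℝ) < P := hS.trans hSP
  have hmin := iInf_piMarg_pos hp hη
  obtain ⟨γ, Q⟩ := y
  cases Q
  · have h0 : μ {ω | Z 1 ω = (γ, false)} = 0 := by
      refine measure_mono_null (fun ω hω => ?_) (ae_iff.1 hZ1)
      rw [Set.mem_ofPred_eq] at hω ⊢
      simp [hω]
    rw [measureReal_def, h0, ENNReal.toReal_zero]
    have := (piJoint_pos hp hη hS hSP (γ, false)).le
    positivity
  · refine measureReal_le_one.trans ?_
    have hle := iInf_piMarg_le (p := p) (η := η) γ
    have : (P : ℝ) / (S * ⨅ γ, piMarg p η γ) * piJoint p η S (γ, true)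
        = piMarg p η γ / ⨅ γ, piMarg p η γ := by
      simp only [piJoint, bern, if_true]
      field_simp
    rw [this, one_le_div hmin]
    exact hle

/-- The moment generating function of an additive functional of either chain. -/
theorem integral_exp_path_le (hp : ∀ γ, 0 < p γ) (hη : ∀ j g, 0 < η j g) (hS : 0 < S)
    (hSP : S < P)
    (hZ : IsMarkovChain μ (kernelRev p η S) Z ∨ IsMarkovChain μ (kernelAlg p η S) Z)
    (hZ1 : ∀ᵐ ω ∂μ, (Z 1 ω).2 = true) {g : State P → ℝ} (hg : ∀ x, |g x| ≤ 1)
    (hg0 : ∑ x, piJoint p η S x * g x = 0) {θ : ℝ} (hθ0 : 0 ≤ θ)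
    (hθ : θ ≤ (1 - lamGQ p η S) / 32) (n : ℕ) :
    ∫ ω, ∏ t ∈ Finset.Icc 1 (n + 1), Real.exp (θ * g (Z t ω)) ∂μ
      ≤ P / (S * ⨅ γ, piMarg p η γ) * (2 * (1 + 16 * θ ^ 2 / (1 - lamGQ p η S)) ^ n) := by
  have hP : (0 : ℝ) < P := hS.trans hSP
  have hmin := iInf_piMarg_pos hp hη
  have hκ : 0 < 1 - lamGQ p η S := sub_pos.2 (lamGQ_lt_one hp hη hS hSP)
  have hκ1 : 1 - lamGQ p η S ≤ 1 := sub_le_self _ lamGQ_nonneg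
  have hs0 : 0 ≤ S / P := by positivity
  have hs1 : S / P ≤ 1 := (div_le_one hP).2 hSP.le
  have hπ := piMarg_pos hp hη
  set e : State P → ℝ := fun x => Real.exp (θ * g x) with he
  have hθg : ∀ x, |θ * g x| ≤ θ := fun x => by
    rw [abs_mul, abs_of_nonneg hθ0]
    exact mul_le_of_le_one_right hθ0 (hg x)
  have hθg1 : ∀ x, |θ * g x| ≤ 1 := fun x => (hθg x).trans (by linarith)
  have hsq : ∀ x, (θ * g x) ^ 2 ≤ θ ^ 2 := fun x =>
    sq_le_sq' (by linarith [(abs_le.1 (hθg x)).1]) (abs_le.1 (hθg x)).2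
  have hexp : ∀ x, |e x - 1| ≤ 11 / 10 * θ := by
    intro x
    obtain ⟨h1, h2⟩ := abs_le.1 (Real.abs_exp_sub_one_sub_id_le (hθg1 x))
    obtain ⟨h3, h4⟩ := abs_le.1 (hθg x)
    have h5 := hsq x
    have h6 : θ ^ 2 ≤ θ / 32 := by nlinarith
    simp only [he]
    rw [abs_le]
    constructor <;> linarith
  have hmean : ∑ x, piJoint p η S x * e x ≤ 1 + θ ^ 2 := by
    calc ∑ x, piJoint p η S x * e x
        ≤ ∑ x, (piJoint p η S x * (1 + θ ^ 2) + θ * (piJoint p η S x * g x)) := by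
          refine Finset.sum_le_sum fun x _ => ?_
          have h1 := (abs_le.1 (Real.abs_exp_sub_one_sub_id_le (hθg1 x))).2
          have h2 := hsq x
          have h3 : e x ≤ 1 + θ ^ 2 + θ * g x := by simp only [he]; linarith
          have := mul_le_mul_of_nonneg_left h3 (piJoint_pos hp hη hS hSP x).le
          linarith
      _ = 1 + θ ^ 2 := by
          rw [Finset.sum_add_distrib, ← Finset.sum_mul, ← Finset.mul_sum, hg0,
            sum_piJoint hp hη]
          ring
  rw [sum_piJoint_mul] at hmean
  set ψ : Incl P → ℝ := fun γ => S / P * e (γ, true) + (1 - S / P) * e (γ, false) with hψdef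
  have hψ : ∀ γ, |ψ γ - 1| ≤ 11 / 10 * θ := fun γ =>
    abs_convexCombination_le hs0 hs1 (hexp _) (hexp _)
  -- the common argument for the two kernels
  have key : ∀ (K : State P → State P → ℝ) (D₁ D₀ : Incl P → ℝ), IsMarkovChain μ K Z →
      (∀ (v : Incl P → ℝ) (x : State P), act (fun a b => K a b * e b) (fun y => v y.1) x
        = act (tilted (S / P) (flipKernel p η) D₁ D₀) v x.1) →
      (∀ γ, |D₁ γ - 1| ≤ 11 / 10 * θ) → (∀ γ, |D₀ γ - 1| ≤ 11 / 10 * θ) →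
      ∑ γ, piMarg p η γ * (S / P * D₁ γ + (1 - S / P) * D₀ γ) ≤ 1 + θ ^ 2 →
      ∫ ω, ∏ t ∈ Finset.Icc 1 (n + 1), e (Z t ω) ∂μ
        ≤ P / (S * ⨅ γ, piMarg p η γ) * (2 * (1 + 16 * θ ^ 2 / (1 - lamGQ p η S)) ^ n) := by
    intro K D₁ D₀ hK hlift hD₁ hD₀ hD
    set A := tilted (S / P) (flipKernel p η) D₁ D₀ with hA
    have hiter : ∀ x : State P, (act fun a b => K a b * e b)^[n] 1 x = (act A)^[n] 1 x.1 := by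
      have hsemi : Function.Semiconj (fun (v : Incl P → ℝ) (x : State P) => v x.1) (act A)
          (act fun a b => K a b * e b) := fun v => funext fun x => (hlift v x).symm
      intro x
      exact (congrFun ((hsemi.iterate_right n) 1) x).symm
    have hA0 : ∀ γ γ', 0 ≤ A γ γ' := by
      intro γ γ'
      have h1 := (abs_le.1 (hD₁ γ')).1
      have h0 := (abs_le.1 (hD₀ γ')).1
      refine add_nonneg (mul_nonneg hs0 (mul_nonneg (flipKernel_nonneg hp hη _ _) (by linarith)))
        (mul_nonneg (by linarith) ?_)
      split_ifs
      exacts [by linarith, le_rfl]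
    rw [hK.integral_prod e n]
    calc ∑ y, μ.real {ω | Z 1 ω = y} * (e y * (act fun a b => K a b * e b)^[n] 1 y)
        ≤ ∑ y, P / (S * ⨅ γ, piMarg p η γ)
            * (piJoint p η S y * (e y * (act A)^[n] 1 y.1)) := by
          refine Finset.sum_le_sum fun y _ => ?_
          rw [hiter, ← mul_assoc ((P : ℝ) / _)]
          exact mul_le_mul_of_nonneg_right (measureReal_initial_le hp hη hS hSP hZ1 y)
            (mul_nonneg (Real.exp_pos _).le
              (iterate_act_nonneg hA0 (fun _ => zero_le_one) n y.1))
      _ = P / (S * ⨅ γ, piMarg p η γ) * ∑ γ, piMarg p η γ * (ψ γ * (act A)^[n] 1 γ) := by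
          rw [← Finset.mul_sum, sum_piJoint_mul fun y => e y * (act A)^[n] 1 y.1]
          congr 1
          refine Finset.sum_congr rfl fun γ _ => ?_
          simp only [hψdef]
          ring
      _ ≤ _ := by
          refine mul_le_mul_of_nonneg_left ?_ (by positivity)
          exact sum_iterate_tilted_le (fun γ => (hπ γ).le) (sum_piMarg hp hη)
            (flipKernel_nonneg hp hη) (piMarg_mul_flipKernel hp hη) hs0 hs1 hκ hκ1 hθ0 hθ
            (flipKernel_gap hp hη hS hSP) hD₁ hD₀ hψ hD n
  rcases hZ with hZ | hZ
  · refine key _ ψ ψ hZ (act_kernelRev_lift e) hψ hψ ?_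
    refine le_trans (le_of_eq (Finset.sum_congr rfl fun γ _ => ?_)) hmean
    simp only [hψdef]
    ring
  · exact key _ _ _ hZ (act_kernelAlg_lift e) (fun γ => hexp _) (fun γ => hexp _) hmean

/-- A one-sided Chernoff bound for both chains, at the optimal tilt `θ = δ (1 - λ) / 32`. -/
theorem measure_sum_ge_le (hp : ∀ γ, 0 < p γ) (hη : ∀ j g, 0 < η j g) (hS : 0 < S)
    (hSP : S < P)
    (hZ : IsMarkovChain μ (kernelRev p η S) Z ∨ IsMarkovChain μ (kernelAlg p η S) Z)
    (hZ1 : ∀ᵐ ω ∂μ, (Z 1 ω).2 = true) {g : State P → ℝ} (hg : ∀ x, |g x| ≤ 1)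
    (hg0 : ∑ x, piJoint p η S x * g x = 0) {δ : ℝ} (hδ0 : 0 ≤ δ) (hδ1 : δ ≤ 1) {T : ℕ}
    (hT : 1 ≤ T) :
    μ.real {ω | δ * T ≤ ∑ t ∈ Finset.Icc 1 T, g (Z t ω)}
      ≤ P / (S * ⨅ γ, piMarg p η γ)
        * (2 * Real.exp (-(δ ^ 2 * (1 - lamGQ p η S) * T / 64))) := by
  have hP : (0 : ℝ) < P := hS.trans hSP
  have hmin := iInf_piMarg_pos hp hη
  obtain ⟨n, rfl⟩ : ∃ n, T = n + 1 := ⟨T - 1, by omega⟩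
  set κ := 1 - lamGQ p η S with hκdef
  have hκ : 0 < κ := sub_pos.2 (lamGQ_lt_one hp hη hS hSP)
  set θ := δ * κ / 32 with hθdef
  have hθ0 : 0 ≤ θ := by positivity
  have hθ : θ ≤ κ / 32 := by
    rw [hθdef]
    nlinarith
  have hprod : ∀ ω, Real.exp (θ * ∑ t ∈ Finset.Icc 1 (n + 1), g (Z t ω))
      = ∏ t ∈ Finset.Icc 1 (n + 1), Real.exp (θ * g (Z t ω)) := fun ω => by
    rw [Finset.mul_sum, Real.exp_sum]
  have hmeas : ∀ t, 1 ≤ t → Measurable (Z t) := hZ.elim (fun h => h.1) fun h => h.1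
  have hint : Integrable
      (fun ω => Real.exp (θ * ∑ t ∈ Finset.Icc 1 (n + 1), g (Z t ω))) μ := by
    simp_rw [hprod]
    exact integrable_prod_path hmeas (fun x => Real.exp (θ * g x))
      fun t ht => (Finset.mem_Icc.1 ht).1
  refine (measure_ge_le_exp_mul_mgf (δ * ((n + 1 : ℕ) : ℝ)) hθ0 hint).trans ?_
  have hmgf : mgf (fun ω => ∑ t ∈ Finset.Icc 1 (n + 1), g (Z t ω)) μ θ
      ≤ P / (S * ⨅ γ, piMarg p η γ) * (2 * (1 + 16 * θ ^ 2 / κ) ^ n) := by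
    rw [mgf]
    simp_rw [hprod]
    exact integral_exp_path_le hp hη hS hSP hZ hZ1 hg hg0 hθ0 hθ n
  have hpow : (1 + 16 * θ ^ 2 / κ) ^ n ≤ Real.exp (((n + 1 : ℕ) : ℝ) * (16 * θ ^ 2 / κ)) := by
    have h1 : 1 ≤ 1 + 16 * θ ^ 2 / κ := le_add_of_nonneg_right (by positivity)
    calc (1 + 16 * θ ^ 2 / κ) ^ n ≤ (1 + 16 * θ ^ 2 / κ) ^ (n + 1) :=
          pow_le_pow_right₀ h1 n.le_succ
      _ ≤ Real.exp (16 * θ ^ 2 / κ) ^ (n + 1) := by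
          refine pow_le_pow_left₀ (by linarith) ?_ _
          rw [add_comm]
          exact Real.add_one_le_exp _
      _ = _ := by rw [← Real.exp_nat_mul]
  calc Real.exp (-θ * (δ * ((n + 1 : ℕ) : ℝ)))
        * mgf (fun ω => ∑ t ∈ Finset.Icc 1 (n + 1), g (Z t ω)) μ θ
      ≤ Real.exp (-θ * (δ * ((n + 1 : ℕ) : ℝ))) * (P / (S * ⨅ γ, piMarg p η γ)
          * (2 * Real.exp (((n + 1 : ℕ) : ℝ) * (16 * θ ^ 2 / κ)))) := by
        refine mul_le_mul_of_nonneg_left (hmgf.trans ?_) (Real.exp_pos _).le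
        exact mul_le_mul_of_nonneg_left (by linarith) (by positivity)
    _ = P / (S * ⨅ γ, piMarg p η γ) * (2 * (Real.exp (-θ * (δ * ((n + 1 : ℕ) : ℝ)))
          * Real.exp (((n + 1 : ℕ) : ℝ) * (16 * θ ^ 2 / κ)))) := by ring
    _ = _ := by
        rw [← Real.exp_add]
        congr 3
        rw [hθdef]
        field_simp
        ring

end Chernoff

/-! ### The self-normalized estimator -/

section MeanSquaredError

/-- If numerator and denominator of a ratio estimator deviate from their means `A q` and `A` by less than
`ε q A` per step, then the ratio is close to `q`. -/
theorem abs_div_sub_sq_le {n d A q ε T : ℝ} (hA : 0 < A) (hq : 0 < q) (hq1 : q ≤ 1) (hε0 : 0 ≤ ε)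
    (hε1 : ε < 1) (hT : 0 < T) (hd : |d - T * A| ≤ ε * q * A * T)
    (hn : |n - T * (A * q)| ≤ ε * q * A * T) :
    |n / d - q| ^ 2 ≤ 4 * ε ^ 2 / (1 - ε) ^ 2 * q ^ 2 := by
  obtain ⟨hd1, hd2⟩ := abs_le.1 hd
  have hTA : 0 < T * A := mul_pos hT hA
  have hlow : T * A * (1 - ε) ≤ d := by nlinarith [mul_nonneg hε0 hTA.le]
  have hlow0 : 0 < T * A * (1 - ε) := mul_pos hTA (by linarith)
  have hd0 : 0 < d := hlow0.trans_le hlow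
  have hnum : |n - q * d| ≤ 2 * (ε * q * A * T) := by
    have hqd : |q * (d - T * A)| ≤ ε * q * A * T := by
      rw [abs_mul, abs_of_pos hq]
      exact (mul_le_of_le_one_left (abs_nonneg _) hq1).trans hd
    have : n - q * d = (n - T * (A * q)) - q * (d - T * A) := by ring
    rw [this]
    exact (abs_sub _ _).trans (by linarith)
  have hbound : |n / d - q| ≤ 2 * ε / (1 - ε) * q := by
    rw [div_sub' hd0.ne', abs_div, abs_of_pos hd0, mul_comm d q, div_le_iff₀ hd0]
    calc |n - q * d| ≤ 2 * (ε * q * A * T) := hnum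
      _ = 2 * ε / (1 - ε) * q * (T * A * (1 - ε)) := by
          have : 1 - ε ≠ 0 := by linarith
          field_simp
      _ ≤ _ := mul_le_mul_of_nonneg_left hlow
          (mul_nonneg (div_nonneg (by linarith) (by linarith)) hq.le)
  calc |n / d - q| ^ 2 ≤ (2 * ε / (1 - ε) * q) ^ 2 := pow_le_pow_left₀ (abs_nonneg _) hbound 2
    _ = _ := by rw [mul_pow, div_pow]; ring

theorem two_mul_exp_neg_le {T : ℕ} (hT : 2 ≤ T) :
    2 * Real.exp (-(Real.exp 1 * Real.log T)) ≤ 1 / T := by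
  have hT' : (2 : ℝ) ≤ T := by exact_mod_cast hT
  have hlog : 0 ≤ Real.log T := Real.log_nonneg (by linarith)
  have he : (2 : ℝ) ≤ Real.exp 1 := by linarith [Real.add_one_le_exp (1 : ℝ)]
  have h1 : Real.exp (-(Real.exp 1 * Real.log T)) ≤ 1 / (T : ℝ) ^ 2 := by
    calc Real.exp (-(Real.exp 1 * Real.log T)) ≤ Real.exp (-(2 * Real.log T)) :=
          Real.exp_le_exp.2 (neg_le_neg (mul_le_mul_of_nonneg_right he hlog))
      _ = 1 / (T : ℝ) ^ 2 := by
          rw [Real.exp_neg, two_mul, Real.exp_add, Real.exp_log (by linarith), pow_two, one_div]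
  calc 2 * Real.exp (-(Real.exp 1 * Real.log T)) ≤ T * (1 / (T : ℝ) ^ 2) :=
        mul_le_mul hT' h1 (Real.exp_pos _).le (by linarith)
    _ = 1 / T := by field_simp

variable {P : ℕ} {p : Incl P → ℝ} {η : (j : Fin P) → ({k : Fin P // k ≠ j} → Bool) → ℝ} {S : ℝ}

theorem le_iSup_inv_phi (γ : Incl P) : (phi p η γ)⁻¹ ≤ ⨆ γ', (phi p η γ')⁻¹ :=
  le_ciSup (f := fun γ' => (phi p η γ')⁻¹) (Set.finite_range _).bddAbove γ

variable (p η) in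
/-- The importance weight `φ̂(γ) Q` of a state, scaled into `[0, 1]`. -/
def unitWeight (x : State P) : ℝ := phiHat p η x.1 * (if x.2 then 1 else 0)

theorem sum_piJoint_mul_unitWeight (S : ℝ) :
    ∑ x, piJoint p η S x * unitWeight p η x = S / P * ∑ γ, piMarg p η γ * phiHat p η γ := by
  rw [sum_piJoint_mul, Finset.mul_sum]
  refine Finset.sum_congr rfl fun γ _ => ?_
  simp only [unitWeight, if_true, Bool.false_eq_true, if_false]
  ring

theorem tendsto_eps0 (p : Incl P → ℝ) (η : (j : Fin P) → ({k : Fin P // k ≠ j} → Bool) → ℝ)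
    (i : Fin P) (hlam : lamGQ p η S < 1) :
    Tendsto (fun T : ℕ => eps0 p η S i T) atTop (𝓝 0) := by
  have hκ : (1 - lamGQ p η S) ≠ 0 := by linarith
  -- `log T / T` tends to `0`
  have h1 := (Real.tendsto_pow_log_div_mul_add_atTop (1 - lamGQ p η S) 0 1 hκ).comp
    tendsto_natCast_atTop_atTop
  have h2 : Tendsto
      (fun T : ℕ => 64 * Real.exp 1 * Real.log T / ((1 - lamGQ p η S) * T)) atTop (𝓝 0) := by
    have h3 := h1.const_mul (64 * Real.exp 1)
    rw [mul_zero] at h3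
    refine h3.congr fun T => ?_
    simp only [Function.comp, pow_one, add_zero]
    ring
  have h4 := (Real.continuous_sqrt.tendsto 0).comp h2
  rw [Real.sqrt_zero] at h4
  have h5 := h4.const_mul (P / (PIP p i * (∑ γ, piMarg p η γ * phiHat p η γ) * S))
  rw [mul_zero] at h5
  exact h5

theorem tendsto_errBound (p : Incl P → ℝ)
    (η : (j : Fin P) → ({k : Fin P // k ≠ j} → Bool) → ℝ) (i : Fin P)
    (hlam : lamGQ p η S < 1) :
    Tendsto (fun T : ℕ => errBound p η S i T) atTop (𝓝 0) := by
  have hε := tendsto_eps0 p η i hlam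
  have h1 : Tendsto (fun T : ℕ => 4 * eps0 p η S i T ^ 2 / (1 - eps0 p η S i T) ^ 2 * PIP p i ^ 2)
      atTop (𝓝 (4 * 0 ^ 2 / (1 - 0) ^ 2 * PIP p i ^ 2)) :=
    (((hε.pow 2).const_mul 4).div ((hε.const_sub 1).pow 2) (by norm_num)).mul_const _
  have h2 : Tendsto (fun T : ℕ => 4 * P / S * (1 / ((⨅ γ, piMarg p η γ) * T))) atTop (𝓝 0) := by
    have h3 := (tendsto_one_div_atTop_nhds_zero_nat (𝕜 := ℝ)).const_mul
      (4 * P / S * (⨅ γ, piMarg p η γ)⁻¹)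
    rw [mul_zero] at h3
    refine h3.congr fun T => ?_
    rw [one_div, one_div, mul_inv, mul_assoc]
  have h := h1.add h2
  norm_num at h
  refine h.congr fun T => ?_
  simp [errBound]

variable [Nonempty (Fin P)]

theorem iSup_inv_phi_pos (hp : ∀ γ, 0 < p γ) (hη : ∀ j g, 0 < η j g) :
    0 < ⨆ γ', (phi p η γ')⁻¹ :=
  (inv_pos.2 (phi_pos hp hη fun _ => true)).trans_le (le_iSup_inv_phi _)

theorem phiHat_pos (hp : ∀ γ, 0 < p γ) (hη : ∀ j g, 0 < η j g) (γ : Incl P) :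
    0 < phiHat p η γ :=
  div_pos (inv_pos.2 (phi_pos hp hη γ)) (iSup_inv_phi_pos hp hη)

theorem phiHat_le_one (hp : ∀ γ, 0 < p γ) (hη : ∀ j g, 0 < η j g) (γ : Incl P) :
    phiHat p η γ ≤ 1 :=
  (div_le_one (iSup_inv_phi_pos hp hη)).2 (le_iSup_inv_phi γ)

theorem sum_phiHat_pos (hp : ∀ γ, 0 < p γ) (hη : ∀ j g, 0 < η j g) :
    0 < ∑ γ, piMarg p η γ * phiHat p η γ :=
  Finset.sum_pos (fun γ _ => mul_pos (piMarg_pos hp hη γ) (phiHat_pos hp hη γ))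
    Finset.univ_nonempty

theorem sum_phiHat_le_one (hp : ∀ γ, 0 < p γ) (hη : ∀ j g, 0 < η j g) :
    ∑ γ, piMarg p η γ * phiHat p η γ ≤ 1 := by
  rw [← sum_piMarg hp hη]
  exact Finset.sum_le_sum fun γ _ =>
    mul_le_of_le_one_right (piMarg_pos hp hη γ).le (phiHat_le_one hp hη γ)

/-- Importance weighting by `φ⁻¹` turns `π` back into `p`, so the weighted mean of the conditional
inclusion probabilities is `PIP(i)` times the mean weight. -/
theorem sum_phiHat_mul_condProb (hp : ∀ γ, 0 < p γ) (hp1 : ∑ γ, p γ = 1)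
    (hη : ∀ j g, 0 < η j g) (i : Fin P) :
    ∑ γ, piMarg p η γ * (phiHat p η γ * condProb p i true γ)
      = (∑ γ, piMarg p η γ * phiHat p η γ) * PIP p i := by
  set C := ((∑ γ, target p η γ) * ⨆ γ', (phi p η γ')⁻¹)⁻¹ with hC
  have h : ∀ γ, piMarg p η γ * phiHat p η γ = C * p γ := by
    intro γ
    have h1 := (phi_pos hp hη γ).ne'
    rw [piMarg, phiHat, target, hC, mul_inv]
    field_simp
  simp_rw [← mul_assoc, h]
  rw [← Finset.mul_sum, hp1, mul_one]
  simp_rw [mul_assoc]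
  rw [← Finset.mul_sum, sum_mul_condProb hp]

theorem unitWeight_nonneg (hp : ∀ γ, 0 < p γ) (hη : ∀ j g, 0 < η j g) (x : State P) :
    0 ≤ unitWeight p η x :=
  mul_nonneg (phiHat_pos hp hη _).le (by split_ifs <;> simp)

theorem unitWeight_le_one (hp : ∀ γ, 0 < p γ) (hη : ∀ j g, 0 < η j g) (x : State P) :
    unitWeight p η x ≤ 1 := by
  unfold unitWeight
  split_ifs
  · simpa using phiHat_le_one hp hη _
  · simp

theorem sum_piJoint_mul_unitWeight_mul_condProb (hp : ∀ γ, 0 < p γ) (hp1 : ∑ γ, p γ = 1)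
    (hη : ∀ j g, 0 < η j g) (S : ℝ) (i : Fin P) :
    ∑ x, piJoint p η S x * (unitWeight p η x * condProb p i true x.1)
      = S / P * (∑ γ, piMarg p η γ * phiHat p η γ) * PIP p i := by
  rw [sum_piJoint_mul fun x => unitWeight p η x * condProb p i true x.1, mul_assoc,
    ← sum_phiHat_mul_condProb hp hp1 hη, Finset.mul_sum]
  refine Finset.sum_congr rfl fun γ _ => ?_
  simp only [unitWeight, if_true, Bool.false_eq_true, if_false]
  ring

theorem estimator_eq (hp : ∀ γ, 0 < p γ) (hη : ∀ j g, 0 < η j g) (i : Fin P) (T : ℕ)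
    (z : ℕ → State P) :
    estimator p η i T z
      = (∑ t ∈ Finset.Icc 1 T, unitWeight p η (z t) * condProb p i true (z t).1)
        / ∑ t ∈ Finset.Icc 1 T, unitWeight p η (z t) := by
  have hm := (iSup_inv_phi_pos hp hη).ne'
  have hraw : ∀ x, rawWeight p η x = (⨆ γ', (phi p η γ')⁻¹) * unitWeight p η x := by
    intro x
    rw [rawWeight, unitWeight, phiHat, ← mul_assoc, mul_div_cancel₀ _ hm]
  unfold estimator
  simp_rw [hraw]
  rw [← Finset.mul_sum, Finset.sum_div]
  refine Finset.sum_congr rfl fun t _ => ?_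
  rw [mul_div_mul_left _ _ hm]
  ring

theorem estimator_mem_Icc (hp : ∀ γ, 0 < p γ) (hη : ∀ j g, 0 < η j g) (i : Fin P) (T : ℕ)
    (z : ℕ → State P) : estimator p η i T z ∈ Set.Icc (0 : ℝ) 1 := by
  rw [estimator_eq hp hη]
  have h0 : ∀ t, 0 ≤ unitWeight p η (z t) := fun t => unitWeight_nonneg hp hη _
  have hd : 0 ≤ ∑ t ∈ Finset.Icc 1 T, unitWeight p η (z t) := Finset.sum_nonneg fun t _ => h0 t
  refine ⟨div_nonneg (Finset.sum_nonneg fun t _ =>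
    mul_nonneg (h0 t) (condProb_pos hp _ _ _).le) hd, div_le_one_of_le₀ ?_ hd⟩
  exact Finset.sum_le_sum fun t _ => mul_le_of_le_one_right (h0 t) (condProb_le_one hp _ _ _)

theorem sq_error_le_one (hp : ∀ γ, 0 < p γ) (hp1 : ∑ γ, p γ = 1) (hη : ∀ j g, 0 < η j g)
    (i : Fin P) (T : ℕ) (z : ℕ → State P) : |estimator p η i T z - PIP p i| ^ 2 ≤ 1 := by
  obtain ⟨h0, h1⟩ := estimator_mem_Icc hp hη i T z
  refine pow_le_one₀ (abs_nonneg _) ?_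
  rw [abs_le]
  constructor
  · linarith [PIP_le_one hp hp1 i]
  · linarith [PIP_pos hp i]

theorem eps0_nonneg (hp : ∀ γ, 0 < p γ) (hη : ∀ j g, 0 < η j g) (hS : 0 < S) (i : Fin P) (T : ℕ) :
    0 ≤ eps0 p η S i T := by
  have := PIP_pos hp i
  have := sum_phiHat_pos hp hη
  unfold eps0
  positivity

/-- The deviation `δ = ε₀ PIP(i) A` of the empirical averages that corresponds to `ε₀`. -/
theorem eps0_mul (hp : ∀ γ, 0 < p γ) (hη : ∀ j g, 0 < η j g) (hS : 0 < S) (hSP : S < P)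
    (i : Fin P) (T : ℕ) :
    eps0 p η S i T * PIP p i * (S / P * ∑ γ, piMarg p η γ * phiHat p η γ)
      = √(64 * Real.exp 1 * Real.log T / ((1 - lamGQ p η S) * T)) := by
  have hP : (0 : ℝ) < P := hS.trans hSP
  have h1 := PIP_pos hp i
  have h2 := sum_phiHat_pos hp hη
  unfold eps0
  field_simp

variable {Ω : Type*} [MeasurableSpace Ω] {μ : Measure Ω} [IsProbabilityMeasure μ]
  {Z : ℕ → Ω → State P}

theorem mse_le_one (hp : ∀ γ, 0 < p γ) (hp1 : ∑ γ, p γ = 1) (hη : ∀ j g, 0 < η j g)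
    (i : Fin P) (T : ℕ) : mse p η μ Z i T ≤ 1 := by
  refine (integral_mono_of_nonneg (ae_of_all _ fun ω => sq_nonneg _) (integrable_const (1 : ℝ))
    (ae_of_all _ fun ω => sq_error_le_one hp hp1 hη i T _)).trans ?_
  simp

/-- At the deviation `δ` that corresponds to `ε₀` a centered empirical average deviates with probability
of order `1 / T`. -/
theorem measure_abs_sum_ge_le (hp : ∀ γ, 0 < p γ) (hη : ∀ j g, 0 < η j g) (hS : 0 < S)
    (hSP : S < P)
    (hZ : IsMarkovChain μ (kernelRev p η S) Z ∨ IsMarkovChain μ (kernelAlg p η S) Z)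
    (hZ1 : ∀ᵐ ω ∂μ, (Z 1 ω).2 = true) {g : State P → ℝ} (hg : ∀ x, |g x| ≤ 1)
    (hg0 : ∑ x, piJoint p η S x * g x = 0) {δ : ℝ} (hδ0 : 0 ≤ δ) (hδ1 : δ ≤ 1) {T : ℕ}
    (hT : 2 ≤ T) (hδ : δ ^ 2 * (1 - lamGQ p η S) * T / 64 = Real.exp 1 * Real.log T) :
    μ.real {ω | δ * T ≤ |∑ t ∈ Finset.Icc 1 T, g (Z t ω)|}
      ≤ 2 * (P / (S * ⨅ γ, piMarg p η γ) * (1 / T)) := by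
  have hP : (0 : ℝ) < P := hS.trans hSP
  have hmin := iInf_piMarg_pos hp hη
  have hC : 0 ≤ (P : ℝ) / (S * ⨅ γ, piMarg p η γ) := by positivity
  have tail : ∀ f : State P → ℝ, (∀ x, |f x| ≤ 1) → ∑ x, piJoint p η S x * f x = 0 →
      μ.real {ω | δ * T ≤ ∑ t ∈ Finset.Icc 1 T, f (Z t ω)}
        ≤ P / (S * ⨅ γ, piMarg p η γ) * (1 / T) := by
    intro f hf hf0
    have h := measure_sum_ge_le hp hη hS hSP hZ hZ1 hf hf0 hδ0 hδ1 (by omega : 1 ≤ T)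
    rw [hδ] at h
    exact h.trans (mul_le_mul_of_nonneg_left (two_mul_exp_neg_le hT) hC)
  have h1 := tail g hg hg0
  have h2 := tail (fun x => -g x) (fun x => by rw [abs_neg]; exact hg x)
    (by simp only [mul_neg, Finset.sum_neg_distrib, hg0, neg_zero])
  have hsub : {ω | δ * T ≤ |∑ t ∈ Finset.Icc 1 T, g (Z t ω)|}
      ⊆ {ω | δ * T ≤ ∑ t ∈ Finset.Icc 1 T, g (Z t ω)}
        ∪ {ω | δ * T ≤ ∑ t ∈ Finset.Icc 1 T, -g (Z t ω)} := by
    intro ω hω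
    rw [Set.mem_ofPred_eq] at hω
    simp only [Set.mem_union, Set.mem_ofPred_eq, Finset.sum_neg_distrib]
    exact le_abs.1 hω
  have h3 := (measureReal_mono hsub).trans (measureReal_union_le (μ := μ) _ _)
  linarith

theorem one_le_errBound_one (hp : ∀ γ, 0 < p γ) (hη : ∀ j g, 0 < η j g)
    (hS : 0 < S) (hSP : S < P) (i : Fin P) : 1 ≤ errBound p η S i 1 := by
  have hmin := iInf_piMarg_pos hp hη
  have hmin1 : ⨅ γ, piMarg p η γ ≤ 1 := by
    refine (iInf_piMarg_le fun _ => true).trans ?_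
    rw [← sum_piMarg hp hη]
    exact Finset.single_le_sum (f := piMarg p η) (fun γ _ => (piMarg_pos hp hη γ).le)
      (Finset.mem_univ _)
  have h1 : 1 ≤ 1 / ((⨅ γ, piMarg p η γ) * ((1 : ℕ) : ℝ)) := by
    rw [Nat.cast_one, mul_one]
    exact (one_le_div hmin).2 hmin1
  have h2 : 1 ≤ 4 * P / S := by
    rw [one_le_div hS]
    linarith
  have h3 : 0 ≤ 4 * eps0 p η S i 1 ^ 2 / (1 - eps0 p η S i 1) ^ 2 * PIP p i ^ 2 := by positivity
  have h4 := one_le_mul_of_one_le_of_one_le h2 h1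
  unfold errBound
  linarith

theorem integral_le_add_measure {f : Ω → ℝ} {B : ℝ} {s : Set Ω} (hs : MeasurableSet s)
    (hf0 : ∀ ω, 0 ≤ f ω) (hf1 : ∀ ω, f ω ≤ 1) (hB : 0 ≤ B) (hfB : ∀ ω ∉ s, f ω ≤ B) :
    ∫ ω, f ω ∂μ ≤ B + μ.real s := by
  have hint : Integrable (s.indicator fun _ => (1 : ℝ)) μ :=
    (integrable_const (1 : ℝ)).indicator hs
  calc ∫ ω, f ω ∂μ ≤ ∫ ω, (B + s.indicator (fun _ => (1 : ℝ)) ω) ∂μ := by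
        refine integral_mono_of_nonneg (ae_of_all _ hf0) ((integrable_const B).add hint)
          (ae_of_all _ fun ω => ?_)
        by_cases hω : ω ∈ s
        · simp only [Set.indicator_of_mem hω]
          linarith [hf1 ω]
        · simp only [Set.indicator_of_notMem hω, add_zero]
          exact hfB ω hω
    _ = B + μ.real s := by
        rw [integral_add (integrable_const B) hint, integral_indicator hs]
        simp

/-- The mean-squared error bound: off an event of probability at most `4 P / (S min π T)` both empirical
averages are within `ε₀ PIP(i) A` of their means, and on that event the error is at most `1`. -/
theorem mse_le_errBound (hp : ∀ γ, 0 < p γ) (hp1 : ∑ γ, p γ = 1) (hη : ∀ j g, 0 < η j g)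
    (hS : 0 < S) (hSP : S < P)
    (hZ : IsMarkovChain μ (kernelRev p η S) Z ∨ IsMarkovChain μ (kernelAlg p η S) Z)
    (hZ1 : ∀ᵐ ω ∂μ, (Z 1 ω).2 = true) (i : Fin P) {T : ℕ} (hT : 1 ≤ T)
    (hε : eps0 p η S i T < 1) : mse p η μ Z i T ≤ errBound p η S i T := by
  rcases hT.eq_or_lt with rfl | hT2
  · exact (mse_le_one hp hp1 hη i 1).trans (one_le_errBound_one hp hη hS hSP i)
  have hP : (0 : ℝ) < P := hS.trans hSP
  have hT0 : (0 : ℝ) < T := by exact_mod_cast hT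
  have hmin := iInf_piMarg_pos hp hη
  have hε0 := eps0_nonneg hp hη hS i T
  have hq := PIP_pos hp i
  have hq1 := PIP_le_one hp hp1 i
  have hΦ := sum_phiHat_pos hp hη
  obtain ⟨A, hA⟩ : ∃ A, A = S / P * ∑ γ, piMarg p η γ * phiHat p η γ := ⟨_, rfl⟩
  have hA0 : 0 < A := by rw [hA]; positivity
  have hA1 : A ≤ 1 := by
    rw [hA]
    exact mul_le_one₀ ((div_le_one hP).2 hSP.le) hΦ.le (sum_phiHat_le_one hp hη)
  have hκ : 0 < 1 - lamGQ p η S := sub_pos.2 (lamGQ_lt_one hp hη hS hSP)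
  have hδ0 : 0 ≤ eps0 p η S i T * PIP p i * A := mul_nonneg (mul_nonneg hε0 hq.le) hA0.le
  have hδ1 : eps0 p η S i T * PIP p i * A ≤ 1 :=
    mul_le_one₀ (mul_le_one₀ hε.le hq.le hq1) hA0.le hA1
  have hexpo : (eps0 p η S i T * PIP p i * A) ^ 2 * (1 - lamGQ p η S) * T / 64
      = Real.exp 1 * Real.log T := by
    have hlog : 0 ≤ Real.log T := Real.log_nonneg (by exact_mod_cast hT)
    rw [hA, eps0_mul hp hη hS hSP i T, Real.sq_sqrt (by positivity)]
    field_simp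
  have ha0 := unitWeight_nonneg hp hη
  have ha1 := unitWeight_le_one hp hη
  have habs : ∀ a b : ℝ, 0 ≤ a → a ≤ 1 → 0 ≤ b → b ≤ 1 → |a - b| ≤ 1 := fun a b _ _ _ _ => by
    rw [abs_le]
    constructor <;> linarith
  have hcenter : ∀ (f : State P → ℝ) (c : ℝ), ∑ x, piJoint p η S x * f x = c →
      ∑ x, piJoint p η S x * (f x - c) = 0 := by
    intro f c hf
    simp only [mul_sub]
    rw [Finset.sum_sub_distrib, ← Finset.sum_mul, sum_piJoint hp hη, one_mul, hf, sub_self]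
  have hdev : ∀ (f : State P → ℝ) (c : ℝ) (ω : Ω),
      ∑ t ∈ Finset.Icc 1 T, (f (Z t ω) - c) = ∑ t ∈ Finset.Icc 1 T, f (Z t ω) - T * c := by
    intro f c ω
    rw [Finset.sum_sub_distrib, Finset.sum_const, Nat.card_Icc, nsmul_eq_mul,
      Nat.add_sub_cancel]
  have hmeas : ∀ t, 1 ≤ t → Measurable (Z t) := hZ.elim (fun h => h.1) fun h => h.1
  have hGm : ∀ (f : State P → ℝ) (c : ℝ),
      MeasurableSet {ω | c ≤ |∑ t ∈ Finset.Icc 1 T, f (Z t ω)|} := fun f c =>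
    measurableSet_le measurable_const (Finset.measurable_sum _ fun t ht =>
      (measurable_of_finite f).comp (hmeas t (Finset.mem_Icc.1 ht).1)).abs
  -- the denominator of the estimator
  have htail_d := measure_abs_sum_ge_le hp hη hS hSP hZ hZ1
    (g := fun x => unitWeight p η x - A)
    (fun x => habs _ _ (ha0 x) (ha1 x) hA0.le hA1)
    (hcenter _ _ (by rw [sum_piJoint_mul_unitWeight, hA])) hδ0 hδ1 hT2 hexpo
  -- the numerator of the estimator
  have htail_n := measure_abs_sum_ge_le hp hη hS hSP hZ hZ1
    (g := fun x => unitWeight p η x * condProb p i true x.1 - A * PIP p i)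
    (fun x => habs _ _ (mul_nonneg (ha0 x) (condProb_pos hp _ _ _).le)
      (mul_le_one₀ (ha1 x) (condProb_pos hp _ _ _).le (condProb_le_one hp _ _ _))
      (mul_nonneg hA0.le hq.le) (mul_le_one₀ hA1 hq.le hq1))
    (hcenter (fun x => unitWeight p η x * condProb p i true x.1) _
      (by rw [sum_piJoint_mul_unitWeight_mul_condProb hp hp1 hη, hA])) hδ0 hδ1 hT2 hexpo
  have hmain := integral_le_add_measure (μ := μ)
    (f := fun ω => |estimator p η i T (fun t => Z t ω) - PIP p i| ^ 2)
    (B := 4 * eps0 p η S i T ^ 2 / (1 - eps0 p η S i T) ^ 2 * PIP p i ^ 2)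
    ((hGm (fun x => unitWeight p η x - A) (eps0 p η S i T * PIP p i * A * T)).union
      (hGm (fun x => unitWeight p η x * condProb p i true x.1 - A * PIP p i)
        (eps0 p η S i T * PIP p i * A * T)))
    (fun ω => sq_nonneg _) (fun ω => sq_error_le_one hp hp1 hη i T _) (by positivity)
    (fun ω hω => by
      rw [Set.mem_union, not_or] at hω
      obtain ⟨h1, h2⟩ := hω
      rw [Set.mem_ofPred_eq, not_le, hdev] at h1
      rw [Set.mem_ofPred_eq, not_le,
        hdev fun x => unitWeight p η x * condProb p i true x.1] at h2
      rw [estimator_eq hp hη]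
      exact abs_div_sub_sq_le hA0 hq hq1 hε0 hε hT0 h1.le h2.le)
  refine hmain.trans (add_le_add le_rfl ((measureReal_union_le _ _).trans
    ((add_le_add htail_d htail_n).trans (le_of_eq ?_))))
  field_simp
  ring

end MeanSquaredError

end VCwTGS

end

theorem lemma3 {P N : ℕ} (M : BVS P N)
    (η : (j : Fin P) → ({k : Fin P // k ≠ j} → Bool) → ℝ) (hη : ∀ j g, 0 < η j g)
    (S : ℝ) (hS : 0 < S) (hSP : S < P) (i : Fin P)
    {Ω : Type*} [MeasurableSpace Ω] (μ : Measure Ω) [IsProbabilityMeasure μ]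
    (Z : ℕ → Ω → State P)
    (hZ : IsMarkovChain μ (kernelRev M.posterior η S) Z ∨
      IsMarkovChain μ (kernelAlg M.posterior η S) Z)
    (hZ1 : ∀ᵐ ω ∂μ, (Z 1 ω).2 = true) :
    (∀ T : ℕ, 1 ≤ T → eps0 M.posterior η S i T < 1 →
      mse M.posterior η μ Z i T ≤ errBound M.posterior η S i T) ∧
    Tendsto (fun T : ℕ => errBound M.posterior η S i T) atTop (𝓝 0) ∧
    Tendsto (fun T : ℕ => mse M.posterior η μ Z i T) atTop (𝓝 0) := by
  have : Nonempty (Fin P) := ⟨i⟩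
  have hlam := lamGQ_lt_one M.posterior_pos hη hS hSP
  have hbound : ∀ T : ℕ, 1 ≤ T → eps0 M.posterior η S i T < 1 →
      mse M.posterior η μ Z i T ≤ errBound M.posterior η S i T := fun T hT hε =>
    mse_le_errBound M.posterior_pos M.sum_posterior hη hS hSP hZ hZ1 i hT hε
  have herr := tendsto_errBound M.posterior η i hlam
  refine ⟨hbound, herr, ?_⟩
  refine tendsto_of_tendsto_of_tendsto_of_le_of_le' tendsto_const_nhds herr
    (Eventually.of_forall fun T => integral_nonneg fun ω => sq_nonneg _) ?_
  filter_upwards [eventually_ge_atTop 1,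
    (tendsto_eps0 M.posterior η i hlam).eventually (gt_mem_nhds one_pos)] with T hT hε
  exact hbound T hT hε
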